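/- Let $\kappa$ be an uncountable regular cardinal. A compact Hausdorff space $K$ is $\kappa$-Corson if and only if it has Property $B(\kappa)$, where the notions are as follows. For a set $S$ put $\Sigma_\kappa(S)=\{x\in[0,1]^S : |\{s\in S : x(s)\neq 0\}|<\kappa\}$, with the topology of pointwise convergence. The space $K$ is *$\kappa$-Corson* if it is homeomorphic to a subspace of $\Sigma_\kappa(S)$ for some set $S$. For a cardinal $\theta$ let $H(\theta)$ be the collection of all sets whose transitive closure has cardinality $<\theta$. An elementary submodel $M$ of $\langle H(\theta),\in\rangle$ is *$\kappa$-stable* if $\kappa\in M$ and $\kappa\cap M$ is an initial segment of $\kappa$. We write $K\in M$ if both the underlying set of $K$ and some base of its topology are elements of $M$. In that case, for $x,y\in K$, let $x\sim_M y$ mean that $f(x)=f(y)$ for every $f\in C(K)\cap M$, where $C(K)$ is the set of all continuous functions $K\to\mathbb{R}$. The space $K$ has *Property $B(\kappa)$* if for every big enough cardinal $\theta$ (that is, for all cardinals $\theta\geq\theta_0$, for some cardinal $\theta_0$) and every $\kappa$-stable elementary submodel $M$ of $\langle H(\theta),\in\rangle$ with $K\in M$ and $|M|<\kappa$, the relation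 $\sim_M$ is one-to-one on the closure of $K\cap M$ in $K$: if $x,y\in\overline{K\cap M}$ and $x\sim_M y$, then $x=y$. -/

import Mathlib

universe u

open Cardinal Topology

namespace KappaCorson

/-! ### The class of `κ`-Corson compacta -/

/-- `Σ_κ(S) = {x ∈ [0,1]^S : |supp x| < κ}`, with the topology of pointwise convergence
(as a subspace of the product). -/
def SigmaProduct (κ : Cardinal.{u}) (S : Type u) : Set (S → unitInterval) :=
  {x | #{s : S // x s ≠ 0} < κ}

/-- `K` is topologically embeddable in `Σ_κ(S)` for some set `S`. -/
def IsKappaCorson (κ : Cardinal.{u}) (K : Type u) [TopologicalSpace K] : Prop :=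
  ∃ (S : Type u) (φ : K → SigmaProduct κ S), IsEmbedding φ

/-! ### Elementary submodels of `H(θ)` -/

/-- The only symbol of the language of set theory: a binary relation. -/
inductive SetRel : ℕ → Type
  | mem : SetRel 2

/-- The first-order language `{∈}`. -/
def setLang : FirstOrder.Language :=
  ⟨fun _ => Empty, SetRel⟩

/-- `H(θ)`: the sets whose transitive closure has cardinality `< θ`. (The transitive closure of `x`
is the least transitive set including `x`, so its cardinality is `< θ` iff some transitive set
including `x` has cardinality `< θ`.) -/
def H (θ : Cardinal.{u}) : Set ZFSet.{u} :=
  {x | ∃ t : ZFSet.{u}, t.IsTransitive ∧ x ⊆ t ∧ t.card < θ}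

/-- The structure `⟨H(θ), ∈⟩`. -/
instance structureH (θ : Cardinal.{u}) : setLang.Structure (H θ) where
  funMap f := nomatch f
  RelMap
    | SetRel.mem, v => (v 0 : ZFSet.{u}) ∈ (v 1 : ZFSet.{u})

/-- The elements of an elementary submodel of `H(θ)`, as a collection of sets. -/
def elems {θ : Cardinal.{u}} (M : setLang.ElementarySubstructure (H θ)) : Set ZFSet.{u} :=
  {x | ∃ y ∈ M, (y : ZFSet.{u}) = x}

/-- `M` is `κ`-stable: `κ ∈ M` (`κ` being the initial von Neumann ordinal) and `κ ∩ M` is an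
initial segment of `κ`. -/
def IsStable (κ : Cardinal.{u}) {θ : Cardinal.{u}}
    (M : setLang.ElementarySubstructure (H θ)) : Prop :=
  κ.ord.toZFSet ∈ elems M ∧
    ∀ α ∈ κ.ord.toZFSet, α ∈ elems M → ∀ β ∈ α, β ∈ elems M

/-! ### Spaces, subsets and real-valued functions as sets

A space `K` is regarded as a set through an injection `e` that says which set each point is. -/

section Codes

noncomputable section

/-- The finite von Neumann ordinal `n`. -/
def natCode (n : ℕ) : ZFSet.{u} :=
  (n : Ordinal.{u}).toZFSet

/-- A real number as a Dedekind cut: the set of all formal fractions `(a - b) / c` below `r`,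
where `a, b, c` are natural numbers, `c > 0`, and the fraction is the set `⟨⟨a, b⟩, c⟩`. -/
def realCode (r : ℝ) : ZFSet.{u} :=
  ZFSet.range fun t : {t : ℕ × ℕ × ℕ // 0 < t.2.2 ∧ ((t.1 : ℝ) - t.2.1) / t.2.2 < r} =>
    ZFSet.pair (ZFSet.pair (natCode t.1.1) (natCode t.1.2.1)) (natCode t.1.2.2)

variable {K : Type u}

/-- A subset of `K` as a set. -/
def subsetCode (e : K ↪ ZFSet.{u}) (A : Set K) : ZFSet.{u} :=
  ZFSet.range fun x : A => e x

/-- A family of subsets of `K` as a set. -/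
def familyCode (e : K ↪ ZFSet.{u}) (B : Set (Set K)) : ZFSet.{u} :=
  ZFSet.range fun U : B => subsetCode e U

/-- A real-valued function on `K` as a set of ordered pairs. -/
def funCode (e : K ↪ ZFSet.{u}) (f : K → ℝ) : ZFSet.{u} :=
  ZFSet.range fun x : K => ZFSet.pair (e x) (realCode (f x))

end

end Codes

/-! ### Property `B(κ)` -/

section PropertyB

variable {K : Type u} [TopologicalSpace K] (e : K ↪ ZFSet.{u}) {θ : Cardinal.{u}}
  (M : setLang.ElementarySubstructure (H θ))

/-- `K ∈ M`: the set `K` and a base of its topology are elements of `M`. -/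
def SpaceMem : Prop :=
  subsetCode e Set.univ ∈ elems M ∧
    ∃ B : Set (Set K), TopologicalSpace.IsTopologicalBasis B ∧ familyCode e B ∈ elems M

/-- `x ∼_M y`: every `f ∈ C(K) ∩ M` has the same value at `x` and at `y`. -/
def EquivMod (x y : K) : Prop :=
  ∀ f : C(K, ℝ), funCode e f ∈ elems M → f x = f y

/-- The set `K ∩ M`. -/
def pointsIn : Set K :=
  {x | e x ∈ elems M}

end PropertyB

/-- Property `B(κ)` of the space `K`: for every big enough `θ` and every `κ`-stable elementary
submodel `M` of `⟨H(θ), ∈⟩` with `K ∈ M` and `|M| < κ`, the relation `∼_M` is one-to-one on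
`cl(K ∩ M)`. -/
def PropertyB (κ : Cardinal.{u}) {K : Type u} [TopologicalSpace K] (e : K ↪ ZFSet.{u}) : Prop :=
  ∃ θ₀ : Cardinal.{u}, ∀ θ : Cardinal.{u}, θ₀ ≤ θ →
    ∀ M : setLang.ElementarySubstructure (H θ),
      IsStable κ M → SpaceMem e M → #M < Cardinal.lift.{u + 1} κ →
        ∀ x ∈ closure (pointsIn e M), ∀ y ∈ closure (pointsIn e M), EquivMod e M x y → x = y

end KappaCorson

/-! From `κ`-Corson to `B(κ)`: the coordinates of an embedding into `Σ_κ(S)` are nonnegative,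
separate points, and fewer than `κ` of them are positive at each point. By elementarity `M` contains
a family `F'` of continuous functions that separates points in the same sense and is small at each
point. If `x ≠ y` lie in `cl(K ∩ M)`, some `f ∈ F'` separates them and is positive at one of them,
hence at some `d ∈ K ∩ M`. The members of `F'` positive at `d` are enumerated in `M` by an ordinal
`α ∈ κ ∩ M`; stability gives `α ⊆ M`, so `f ∈ M` (`mem_elems_of_app`) and `x ∼_M y` fails.
Elementarity needs "`f` is a continuous real function" as a formula with parameters in `M`, which is
why arithmetic, Dedekind cuts and continuity are coded (`isContCode_iff`).

From `B(κ)` to `κ`-Corson: submodels are replaced by their traces, sets of points and functions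
closed under a finitary operation with values of size `< κ`. A small closed set `A` is the trace of
a stable submodel, so its functions separate `cl(pts A)`; by reflection this holds for every closed
`A` (`separated_of_small`). After adding points with dense values, `K` retracts onto each `cl(pts
A)` by a map `r A` that preserves the functions in `A`.

Along a well-ordered chain of hulls, the retracts of a fixed point change at fewer than `κ` stages
(`RetractionSystem.mk_jumps_lt`). Induction on `#A` then builds a small separating family on `cl(pts
A)`: families for the stages are combined through the differences `f - f ∘ r (lo i)`, which vanish
at `x` unless `x` jumps at `i` (`RetractionSystem.exists_isSmallFamily`). For `A` the set of all
points and functions this gives an embedding into a `Σ_κ`-product. -/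

namespace KappaCorson

/-! ### Sets closed under a finitary set-valued operation -/

section Hull

universe v

variable {Y : Type v} (Ψ : Finset Y → Set Y)

/-- `C` includes `Ψ s` for every finite `s ⊆ C`. -/
def IsClosedUnder (C : Set Y) : Prop :=
  ∀ s : Finset Y, ↑s ⊆ C → Ψ s ⊆ C

/-- The least set that includes `A` and is closed under `Ψ`. -/
def hull (A : Set Y) : Set Y :=
  ⋂₀ {C | A ⊆ C ∧ IsClosedUnder Ψ C}

variable {Ψ}

theorem subset_hull (A : Set Y) : A ⊆ hull Ψ A :=
  Set.subset_sInter fun _ hC => hC.1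

theorem hull_subset {A C : Set Y} (h : A ⊆ C) (hC : IsClosedUnder Ψ C) : hull Ψ A ⊆ C :=
  Set.sInter_subset_of_mem ⟨h, hC⟩

theorem isClosedUnder_hull (A : Set Y) : IsClosedUnder Ψ (hull Ψ A) :=
  fun s hs => Set.subset_sInter fun _ hC => hC.2 s (hs.trans (Set.sInter_subset_of_mem hC))

theorem hull_mono {A A' : Set Y} (h : A ⊆ A') : hull Ψ A ⊆ hull Ψ A' :=
  hull_subset (h.trans (subset_hull A')) (isClosedUnder_hull A')

theorem IsClosedUnder.inter {A C : Set Y} (hA : IsClosedUnder Ψ A) (hC : IsClosedUnder Ψ C) :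
    IsClosedUnder Ψ (A ∩ C) :=
  fun s hs => Set.subset_inter (hA s (hs.trans Set.inter_subset_left))
    (hC s (hs.trans Set.inter_subset_right))

theorem IsClosedUnder.mono {Ψ' : Finset Y → Set Y} (h : ∀ s, Ψ' s ⊆ Ψ s) {C : Set Y}
    (hC : IsClosedUnder Ψ C) : IsClosedUnder Ψ' C :=
  fun s hs => (h s).trans (hC s hs)

theorem exists_finset_of_mem_hull {A : Set Y} {y : Y} (hy : y ∈ hull Ψ A) :
    ∃ s : Finset Y, ↑s ⊆ A ∧ y ∈ hull Ψ (↑s : Set Y) := by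
  classical
  have key : hull Ψ A ⊆ {y | ∃ s : Finset Y, ↑s ⊆ A ∧ y ∈ hull Ψ (↑s : Set Y)} := by
    refine hull_subset (fun a ha => ⟨{a}, by simpa using ha, subset_hull _ (by simp)⟩) ?_
    intro t ht z hz
    choose! g hgA hg using fun y (hy : y ∈ t) => ht hy
    refine ⟨t.biUnion g, by simpa using hgA, ?_⟩
    refine isClosedUnder_hull _ t (fun y hy => ?_) hz
    exact hull_mono (Finset.coe_subset.2 (Finset.subset_biUnion_of_mem g hy)) (hg y hy)
  exact key hy

theorem mk_union_lt {κ : Cardinal.{v}} (hκ : ℵ₀ ≤ κ) {A B : Set Y} (hA : #A < κ) (hB : #B < κ) :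
    #(A ∪ B : Set Y) < κ :=
  (mk_union_le A B).trans_lt (add_lt_of_lt hκ hA hB)

theorem mk_finset_lt {κ : Cardinal.{v}} (hunc : ℵ₀ < κ) {A : Type v} (hA : #A < κ) :
    #(Finset A) < κ := by
  rcases finite_or_infinite A with h | h
  · exact (lt_aleph0_of_finite _).trans hunc
  · rwa [mk_finset_of_infinite]

/-- Since the operation is finitary, the hull is exhausted by `ω` stages; each stage adds fewer than
`κ` sets of size `< κ`, and regularity with `ℵ₀ < κ` bounds the unions. -/
theorem mk_hull_lt {κ : Cardinal.{v}} (hreg : κ.IsRegular) (hunc : ℵ₀ < κ)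
    (hΨ : ∀ s, #(Ψ s) < κ) {A : Set Y} (hA : #A < κ) : #(hull Ψ A) < κ := by
  classical
  let step : Set Y → Set Y := fun C =>
    C ∪ ⋃ s : Finset C, Ψ (s.map (Function.Embedding.subtype _))
  have step_lt : ∀ C : Set Y, #C < κ → #(step C) < κ := fun C hC =>
    mk_union_lt hreg.aleph0_le hC <|
      (card_iUnion_lt_iff_forall_of_isRegular hreg (mk_finset_lt hunc hC)).2 fun s => hΨ _
  let lev : ℕ → Set Y := fun n => step^[n] A
  have lev_succ : ∀ n, lev (n + 1) = step (lev n) := fun n => Function.iterate_succ_apply' _ _ _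
  have lev_lt : ∀ n, #(lev n) < κ := by
    intro n
    induction n with
    | zero => exact hA
    | succ n ih => rw [lev_succ]; exact step_lt _ ih
  have lev_mono : Monotone lev := monotone_nat_of_le_succ fun n => by
    rw [lev_succ]; exact Set.subset_union_left
  have hsub : hull Ψ A ⊆ ⋃ n : ULift.{v} ℕ, lev n.down := by
    refine hull_subset (Set.subset_iUnion_of_subset ⟨0⟩ subset_rfl) ?_
    intro s hs
    have : ∃ n, ↑s ⊆ lev n := by
      choose! g hg using fun y (hy : y ∈ s) => Set.mem_iUnion.1 (hs hy)
      refine ⟨s.sup fun y => (g y).down, fun y hy => lev_mono ?_ (hg y hy)⟩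
      exact Finset.le_sup (f := fun y => (g y).down) hy
    obtain ⟨n, hn⟩ := this
    refine Set.subset_iUnion_of_subset ⟨n + 1⟩ ?_
    rw [lev_succ]
    refine Set.subset_union_of_subset_right (Set.subset_iUnion_of_subset
      (s.subtype (· ∈ lev n)) ?_) _
    rw [Finset.subtype_map_of_mem fun y hy => hn hy]
  refine (mk_le_mk_of_subset hsub).trans_lt ?_
  exact (card_iUnion_lt_iff_forall_of_isRegular hreg (by simpa using hunc)).2 fun n => lev_lt _

theorem mk_hull_lt_of_le {κ μ : Cardinal.{v}} (hreg : κ.IsRegular) (hunc : ℵ₀ < κ)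
    (hΨ : ∀ s, #(Ψ s) < κ) (hμ : κ ≤ μ) {A : Set Y} (hA : #A < μ) : #(hull Ψ A) < μ := by
  rcases lt_or_ge #A κ with h | h
  · exact (mk_hull_lt hreg hunc hΨ h).trans_le hμ
  · have hA0 : ℵ₀ ≤ #A := hreg.aleph0_le.trans h
    -- `μ` may be singular, so the bound is taken at the regular cardinal `(#A)⁺` and gives `#(hull
    -- Ψ A) ≤ #A`.
    have hs : #A < Order.succ #A := Order.lt_succ _
    have := mk_hull_lt (isRegular_succ hA0) (hA0.trans_lt hs)
      (fun s => (hΨ s).trans (h.trans_lt hs)) hs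
    exact (Order.lt_succ_iff.1 this).trans_lt hA

end Hull

/-! ### Systems of sets of points and functions -/

section Systems

variable {K : Type u} [TopologicalSpace K]

/-- The points that belong to a set of points and functions. -/
def pts (A : Set (K ⊕ C(K, ℝ))) : Set K :=
  Sum.inl ⁻¹' A

/-- The functions that belong to a set of points and functions. -/
def fns (A : Set (K ⊕ C(K, ℝ))) : Set C(K, ℝ) :=
  Sum.inr ⁻¹' A

/-- The functions in `A` separate the points of the closure of the set of points in `A`. -/
def Separated (A : Set (K ⊕ C(K, ℝ))) : Prop :=
  ∀ x ∈ closure (pts A), ∀ y ∈ closure (pts A), (∀ f ∈ fns A, f x = f y) → x = y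

theorem pts_mono {A A' : Set (K ⊕ C(K, ℝ))} (h : A ⊆ A') : closure (pts A) ⊆ closure (pts A') :=
  closure_mono (Set.preimage_mono h)

/-- By compactness: finitely many of the conditions `|f z - f y| ≤ 1 / (n + 1)` can be met
simultaneously in `Q`, so all of them are met at one point of its closure. -/
theorem exists_mem_closure_of_approx [CompactSpace K] {Q : Set K} {G : Set C(K, ℝ)} {y : K}
    (h : ∀ t : Finset C(K, ℝ), ↑t ⊆ G → ∀ n : ℕ, ∃ d ∈ Q, ∀ f ∈ t, |f d - f y| < 1 / (n + 1)) :
    ∃ z ∈ closure Q, ∀ f ∈ G, f z = f y := by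
  classical
  let Z : G × ℕ → Set K := fun i => {z | |i.1.1 z - i.1.1 y| ≤ 1 / ((i.2 : ℝ) + 1)}
  have hZ : ∀ i, IsClosed (Z i) := fun i => isClosed_le (by fun_prop) continuous_const
  obtain ⟨z, hzQ, hz⟩ := (isClosed_closure (s := Q)).isCompact.inter_iInter_nonempty Z hZ
    (fun w => by
      obtain ⟨d, hdQ, hd⟩ := h (w.image fun i => i.1.1) (by
        intro f hf
        simp only [Finset.coe_image, Set.mem_image] at hf
        obtain ⟨i, -, rfl⟩ := hf
        exact i.1.2) (w.sup Prod.snd)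
      refine ⟨d, subset_closure hdQ, Set.mem_iInter₂.2 fun i hi => ?_⟩
      refine (hd i.1.1 (Finset.mem_image_of_mem _ hi)).le.trans ?_
      have : i.2 ≤ w.sup Prod.snd := Finset.le_sup (f := Prod.snd) hi
      gcongr)
  refine ⟨z, hzQ, fun f hf => ?_⟩
  by_contra hne
  obtain ⟨n, hn⟩ := exists_nat_one_div_lt (abs_pos.2 (sub_ne_zero.2 hne))
  exact absurd (Set.mem_iInter.1 hz (⟨f, hf⟩, n)) (not_le.2 hn)

/-- A countable set of points of `Q` that approximate `y` with respect to the functions in `s`. -/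
def approxSet (Q : Set K) (y : K) (s : Finset (K ⊕ C(K, ℝ))) : Set (K ⊕ C(K, ℝ)) :=
  Set.range fun n : {n : ℕ // ∃ d ∈ Q, ∀ f : C(K, ℝ), Sum.inr f ∈ s →
      |f d - f y| < 1 / ((n : ℝ) + 1)} =>
    Sum.inl n.2.choose

theorem countable_approxSet (Q : Set K) (y : K) (s : Finset (K ⊕ C(K, ℝ))) :
    (approxSet Q y s).Countable :=
  Set.countable_range _

theorem exists_approx_of_mem_closure {Q : Set K} {y : K} (hy : y ∈ closure Q)
    (t : Finset C(K, ℝ)) (n : ℕ) : ∃ d ∈ Q, ∀ f ∈ t, |f d - f y| < 1 / ((n : ℝ) + 1) := by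
  have hU : IsOpen (⋂ f ∈ t, {d : K | |f d - f y| < 1 / ((n : ℝ) + 1)}) :=
    isOpen_biInter_finset fun f _ => isOpen_lt (by fun_prop) continuous_const
  obtain ⟨d, hd, hdQ⟩ := mem_closure_iff.1 hy _ hU (by
    simp only [Set.mem_iInter, Set.mem_ofPred_eq, sub_self, abs_zero]
    intros; positivity)
  exact ⟨d, hdQ, fun f hf => Set.mem_iInter₂.1 hd f hf⟩

theorem exists_mem_closure_inter [CompactSpace K] {Q : Set K} {y : K} (hy : y ∈ closure Q)
    {N : Set (K ⊕ C(K, ℝ))} (hN : ∀ s : Finset (K ⊕ C(K, ℝ)), ↑s ⊆ N → approxSet Q y s ⊆ N) :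
    ∃ z ∈ closure (Q ∩ pts N), ∀ f ∈ fns N, f z = f y := by
  classical
  refine exists_mem_closure_of_approx fun t ht n => ?_
  let s : Finset (K ⊕ C(K, ℝ)) := t.image Sum.inr
  have hs : ↑s ⊆ N := by
    intro p hp
    simp only [s, Finset.coe_image, Set.mem_image] at hp
    obtain ⟨f, hf, rfl⟩ := hp
    exact ht hf
  have hmem : ∀ f : C(K, ℝ), Sum.inr f ∈ s ↔ f ∈ t := fun f => by simp [s]
  have hex : ∃ d ∈ Q, ∀ f : C(K, ℝ), Sum.inr f ∈ s → |f d - f y| < 1 / ((n : ℝ) + 1) := by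
    simpa only [hmem] using exists_approx_of_mem_closure hy t n
  refine ⟨hex.choose, ⟨hex.choose_spec.1, hN s hs ⟨⟨n, hex⟩, rfl⟩⟩, fun f hf => ?_⟩
  exact hex.choose_spec.2 f ((hmem f).2 hf)

/-- The approximations in `N` accumulate at a point `z` that agrees with `y` on `fns N`. Both lie in
`closure (pts N)`, so separation forces `z = y`. This is the reflection step behind
`separated_of_small` and `mk_jumps_lt`. -/
theorem mem_closure_inter [CompactSpace K] {N C : Set (K ⊕ C(K, ℝ))} (hsep : Separated N)
    {y : K} (hy : y ∈ closure (pts C)) (hyN : Sum.inl y ∈ N)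
    (hN : ∀ s : Finset (K ⊕ C(K, ℝ)), ↑s ⊆ N → approxSet (pts C) y s ⊆ N) :
    y ∈ closure (pts (C ∩ N)) := by
  obtain ⟨z, hz, hf⟩ := exists_mem_closure_inter hy hN
  have hzN : z ∈ closure (pts N) := closure_mono Set.inter_subset_right hz
  rwa [hsep z hzN y (subset_closure hyN) hf] at hz

/-- Countably many points whose values under the functions in `s` are dense among all values. -/
theorem exists_countable_dense_values (s : Finset (K ⊕ C(K, ℝ))) :
    ∃ E : Set K, E.Countable ∧ ∀ (x : K) (n : ℕ), ∃ d ∈ E,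
      ∀ f : C(K, ℝ), Sum.inr f ∈ s → |f d - f x| < 1 / ((n : ℝ) + 1) := by
  classical
  let S := {f : C(K, ℝ) // Sum.inr f ∈ s}
  have : Finite S := Finite.of_injective (fun f : S => (⟨Sum.inr f.1, f.2⟩ : s)) fun f g h => by
    exact Subtype.ext (Sum.inr_injective (congrArg Subtype.val h))
  have := Fintype.ofFinite S
  let ev : K → S → ℝ := fun x f => f.1 x
  -- Only finitely many functions are involved, so the values lie in a separable `ℝ^n`.
  obtain ⟨t, htr, htc, htd⟩ := (TopologicalSpace.IsSeparable.of_separableSpace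
    (Set.range ev)).exists_countable_dense_subset
  choose g hg using fun v : t => htr v.2
  have := htc.to_subtype
  refine ⟨Set.range g, Set.countable_range g, fun x n => ?_⟩
  obtain ⟨v, hv, hd⟩ := Metric.mem_closure_iff.1 (htd ⟨x, rfl⟩) (1 / ((n : ℝ) + 1)) (by positivity)
  refine ⟨g ⟨v, hv⟩, ⟨_, rfl⟩, fun f hf => ?_⟩
  have h1 := (dist_pi_lt_iff (by positivity)).1 hd ⟨f, hf⟩
  have h2 : v ⟨f, hf⟩ = f (g ⟨v, hv⟩) := (congrFun (hg ⟨v, hv⟩) ⟨f, hf⟩).symm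
  rw [h2, dist_comm, Real.dist_eq] at h1
  exact h1

/-- A countable set of points whose values under the functions in `s` are dense. -/
noncomputable def denseSet (s : Finset (K ⊕ C(K, ℝ))) : Set (K ⊕ C(K, ℝ)) :=
  Sum.inl '' (exists_countable_dense_values s).choose

theorem countable_denseSet (s : Finset (K ⊕ C(K, ℝ))) : (denseSet s).Countable :=
  (exists_countable_dense_values s).choose_spec.1.image _

theorem exists_mem_closure_of_denseSet [CompactSpace K] {A : Set (K ⊕ C(K, ℝ))}
    (hA : IsClosedUnder denseSet A) (x : K) :
    ∃ z ∈ closure (pts A), ∀ f ∈ fns A, f z = f x := by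
  classical
  refine exists_mem_closure_of_approx fun t ht n => ?_
  let s : Finset (K ⊕ C(K, ℝ)) := t.image Sum.inr
  have hs : ↑s ⊆ A := by
    intro p hp
    simp only [s, Finset.coe_image, Set.mem_image] at hp
    obtain ⟨f, hf, rfl⟩ := hp
    exact ht hf
  obtain ⟨d, hd, h⟩ := (exists_countable_dense_values s).choose_spec.2 x n
  exact ⟨d, hA s hs ⟨d, hd, rfl⟩, fun f hf => h f (Finset.mem_image_of_mem _ hf)⟩

/-- If the functions in `A` separate the points of `closure (pts A)` and every point of `K` agrees
on `fns A` with some point of `closure (pts A)`, then `K` retracts onto `closure (pts A)`. -/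
theorem Separated.exists_retraction [CompactSpace K] [T2Space K] {A : Set (K ⊕ C(K, ℝ))}
    (hA : Separated A) (hE : ∀ x, ∃ z ∈ closure (pts A), ∀ f ∈ fns A, f z = f x) :
    ∃ r : C(K, K), ∀ x, r x ∈ closure (pts A) ∧ ∀ f ∈ fns A, f (r x) = f x := by
  choose r hr hf using hE
  have : CompactSpace (closure (pts A)) := isCompact_iff_compactSpace.1 isClosed_closure.isCompact
  let ev : closure (pts A) → fns A → ℝ := fun z f => f.1 z
  have hev : Continuous ev := continuous_pi fun f => f.1.continuous.comp continuous_subtype_val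
  have hinj : Function.Injective ev := fun z w h =>
    Subtype.ext (hA z z.2 w w.2 fun f hf => congrFun h ⟨f, hf⟩)
  let r' : K → closure (pts A) := fun x => ⟨r x, hr x⟩
  -- Evaluation embeds the compact set `closure (pts A)` into a power of `ℝ`, and its composite with
  -- the retraction is coordinatewise just `f`.
  have hr' : Continuous r' := by
    rw [(hev.isClosedEmbedding hinj).isEmbedding.continuous_iff]
    have : ev ∘ r' = fun x (f : fns A) => f.1 x := by
      ext x f
      exact hf x f.1 f.2
    rw [this]
    exact continuous_pi fun f => f.1.continuous
  exact ⟨⟨r, continuous_subtype_val.comp hr'⟩, fun x => ⟨hr x, hf x⟩⟩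

end Systems

/-! ### Retractions onto closures of closed sets, and their jumps -/

section Retractions

variable {K : Type u} [TopologicalSpace K]

/-- A finitary operation `Φ` on points and functions with small values, together with retractions
`r A` of `K` onto `closure (pts A)` for all `A` closed under `Φ`, determined by `fns A`. -/
structure RetractionSystem (κ : Cardinal.{u})
    (Φ : Finset (K ⊕ C(K, ℝ)) → Set (K ⊕ C(K, ℝ)))
    (r : Set (K ⊕ C(K, ℝ)) → C(K, K)) : Prop where
  mk_lt : ∀ s, #(Φ s) < κ
  separated : ∀ A, IsClosedUnder Φ A → Separated A
  mem_closure : ∀ A, IsClosedUnder Φ A → ∀ x, r A x ∈ closure (pts A)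
  apply_eq : ∀ A, IsClosedUnder Φ A → ∀ x, ∀ f ∈ fns A, f (r A x) = f x

/-- If small closed sets of points and functions are separated then all closed sets are. -/
theorem separated_of_small [CompactSpace K] {κ : Cardinal.{u}} (hreg : κ.IsRegular)
    (hunc : ℵ₀ < κ) {Φ : Finset (K ⊕ C(K, ℝ)) → Set (K ⊕ C(K, ℝ))} (hΦ : ∀ s, #(Φ s) < κ)
    (hsep : ∀ A, IsClosedUnder Φ A → #A < κ → Separated A) {A : Set (K ⊕ C(K, ℝ))}
    (hA : IsClosedUnder Φ A) : Separated A := by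
  intro x hx y hy hxy
  -- A small closed `N` containing `x`, `y` and approximations to them from `A` puts both points in
  -- the closure of the points of `A ∩ N`, which is itself small and closed under `Φ`.
  let Ψ : Finset (K ⊕ C(K, ℝ)) → Set (K ⊕ C(K, ℝ)) := fun s =>
    Φ s ∪ (approxSet (pts A) x s ∪ approxSet (pts A) y s)
  have hΨ : ∀ s, #(Ψ s) < κ := fun s => mk_union_lt hreg.aleph0_le (hΦ s)
    (((countable_approxSet _ _ _).union (countable_approxSet _ _ _)).le_aleph0.trans_lt hunc)
  let N := hull Ψ {Sum.inl x, Sum.inl y}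
  have hN : IsClosedUnder Ψ N := isClosedUnder_hull _
  have hNΦ : IsClosedUnder Φ N := hN.mono fun s => Set.subset_union_left
  have hNκ : #N < κ := mk_hull_lt hreg hunc hΨ
    ((Set.toFinite _).countable.le_aleph0.trans_lt hunc)
  have hxN : x ∈ closure (pts (A ∩ N)) := mem_closure_inter (hsep N hNΦ hNκ) hx
    (subset_hull _ (by simp)) fun s hs =>
      (Set.subset_union_of_subset_right Set.subset_union_left _).trans (hN s hs)
  have hyN : y ∈ closure (pts (A ∩ N)) := mem_closure_inter (hsep N hNΦ hNκ) hy
    (subset_hull _ (by simp)) fun s hs =>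
      (Set.subset_union_of_subset_right Set.subset_union_right _).trans (hN s hs)
  exact hsep _ (hA.inter hNΦ) ((mk_le_mk_of_subset Set.inter_subset_right).trans_lt hNκ)
    x hxN y hyN fun f hf => hxy f hf.1

theorem exists_retractionSystem [CompactSpace K] [T2Space K] {κ : Cardinal.{u}}
    (hreg : κ.IsRegular) (hunc : ℵ₀ < κ)
    {Φ : Finset (K ⊕ C(K, ℝ)) → Set (K ⊕ C(K, ℝ))} (hΦ : ∀ s, #(Φ s) < κ)
    (hsep : ∀ A, IsClosedUnder Φ A → #A < κ → Separated A) :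
    ∃ Ψ r, RetractionSystem (K := K) κ Ψ r := by
  let Ψ : Finset (K ⊕ C(K, ℝ)) → Set (K ⊕ C(K, ℝ)) := fun s => Φ s ∪ denseSet s
  have hΨ : ∀ s, #(Ψ s) < κ := fun s =>
    mk_union_lt hreg.aleph0_le (hΦ s) ((countable_denseSet s).le_aleph0.trans_lt hunc)
  have hall : ∀ A, IsClosedUnder Ψ A → Separated A := fun A hA =>
    separated_of_small hreg hunc hΨ
      (fun A hA => hsep A (hA.mono fun s => Set.subset_union_left)) hA
  have : Nonempty C(K, K) := ⟨ContinuousMap.id K⟩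
  choose! r hr using fun A hA => (hall A hA).exists_retraction
    (exists_mem_closure_of_denseSet (hA.mono fun s => Set.subset_union_right))
  exact ⟨Ψ, r, hΨ, hall, fun A hA x => (hr A hA x).1, fun A hA x => (hr A hA x).2⟩

namespace RetractionSystem

variable {κ : Cardinal.{u}} {Φ : Finset (K ⊕ C(K, ℝ)) → Set (K ⊕ C(K, ℝ))}
  {r : Set (K ⊕ C(K, ℝ)) → C(K, K)}

/-- Separation makes `r A x` the only point of `closure (pts A)` agreeing with `x` on `fns A`; all
identities between retractions come from this. -/
theorem eq_apply (h : RetractionSystem κ Φ r) {A : Set (K ⊕ C(K, ℝ))} (hA : IsClosedUnder Φ A)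
    {x z : K}
    (hz : z ∈ closure (pts A)) (hf : ∀ f ∈ fns A, f z = f x) : z = r A x :=
  h.separated A hA z hz _ (h.mem_closure A hA x) fun f hfA => by
    rw [hf f hfA, h.apply_eq A hA x f hfA]

theorem apply_apply (h : RetractionSystem κ Φ r) {A C : Set (K ⊕ C(K, ℝ))}
    (hA : IsClosedUnder Φ A) (hC : IsClosedUnder Φ C) (hCA : C ⊆ A) (x : K) : r C (r A x) = r C x :=
  h.eq_apply hC (h.mem_closure C hC _) fun f hf => by
    rw [h.apply_eq C hC _ f hf, h.apply_eq A hA x f (hCA hf)]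

/-- Along an increasing chain of hulls, the retractions of a given point change at fewer than `κ`
places. -/
theorem mk_jumps_lt [CompactSpace K] (h : RetractionSystem κ Φ r) (hreg : κ.IsRegular)
    (hunc : ℵ₀ < κ) {I : Type u} [LinearOrder I] [WellFoundedLT I] {en : I → K ⊕ C(K, ℝ)}
    (hen : Function.Injective en) (hA : IsClosedUnder Φ (Set.range en)) (x : K) :
    #{i | r (hull Φ (en '' Set.Iio i)) x ≠ r (hull Φ (en '' Set.Iic i)) x} < κ := by
  classical
  let C : Option I → Set (K ⊕ C(K, ℝ)) := fun c =>
    c.elim (Set.range en) fun i => hull Φ (en '' Set.Iio i)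
  have hC : ∀ c, IsClosedUnder Φ (C c) := by
    rintro (_ | i)
    · exact hA
    · exact isClosedUnder_hull _
  -- The rank of `i` is the first stage of the chain of hulls whose hull contains `en i`; it may be
  -- smaller than `i`.
  have hrk : ∀ i, ∃ c, en i ∈ hull Φ (en '' Set.Iic c) ∧
      ∀ c', en i ∈ hull Φ (en '' Set.Iic c') → c ≤ c' := fun i => by
    let S : Set I := {c | en i ∈ hull Φ (en '' Set.Iic c)}
    have hS : S.Nonempty := ⟨i, subset_hull _ ⟨i, le_rfl, rfl⟩⟩
    exact ⟨(wellFounded_lt (α := I)).min S hS, WellFounded.min_mem _ S hS,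
      fun c' hc' => not_lt.1 (WellFounded.not_lt_min _ S hc')⟩
  choose rk hrk hrk_le using hrk
  let idx : Finset (K ⊕ C(K, ℝ)) → Set (Option I) := fun s =>
    insert none (some '' {i | en i ∈ s})
  have hfin : ∀ s : Finset (K ⊕ C(K, ℝ)), {i | en i ∈ s}.Finite := fun s =>
    s.finite_toSet.preimage hen.injOn
  -- Subsets `t` of `s` are used because `s` also has to contain `en i` to name the stage `some i`,
  -- while the approximation required may refer only to the rest.
  let Ψ₁ : Finset (K ⊕ C(K, ℝ)) → Set (K ⊕ C(K, ℝ)) := fun s =>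
    ⋃ c ∈ idx s, ⋃ t ∈ s.powerset,
      insert (Sum.inl (r (C c) x)) (approxSet (pts (C c)) (r (C c) x) t)
  let Ψ₂ : Finset (K ⊕ C(K, ℝ)) → Set (K ⊕ C(K, ℝ)) := fun s =>
    (fun i => en (rk i)) '' {i | en i ∈ s}
  let Ψ : Finset (K ⊕ C(K, ℝ)) → Set (K ⊕ C(K, ℝ)) := fun s => Φ s ∪ (Ψ₁ s ∪ Ψ₂ s)
  have hΨ : ∀ s, #(Ψ s) < κ := fun s => by
    refine mk_union_lt hreg.aleph0_le (h.mk_lt s) (lt_of_le_of_lt ?_ hunc)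
    refine Set.Countable.le_aleph0 (Set.Countable.union ?_ ((hfin s).image _).countable)
    exact (((hfin s).image _).insert _).countable.biUnion fun c _ =>
      s.powerset.countable_toSet.biUnion fun t _ => (countable_approxSet _ _ _).insert _
  let N := hull Ψ ∅
  have hN : IsClosedUnder Ψ N := isClosedUnder_hull _
  have hNΦ : IsClosedUnder Φ N := hN.mono fun s => Set.subset_union_left
  have hN₁ : IsClosedUnder Ψ₁ N := hN.mono fun s =>
    Set.subset_union_of_subset_right Set.subset_union_left _
  have hN₂ : IsClosedUnder Ψ₂ N := hN.mono fun s =>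
    Set.subset_union_of_subset_right Set.subset_union_right _
  have hNκ : #N < κ := mk_hull_lt hreg hunc hΨ (by simpa using hreg.pos)
  have hCN : ∀ c : Option I, (∀ i, c = some i → en i ∈ N) →
      r (C c) x ∈ closure (pts (C c ∩ N)) := by
    intro c hc
    have key : ∀ s : Finset (K ⊕ C(K, ℝ)), ↑s ⊆ N →
        insert (Sum.inl (r (C c) x)) (approxSet (pts (C c)) (r (C c) x) s) ⊆ N := by
      intro s hs
      let s' : Finset (K ⊕ C(K, ℝ)) := s ∪ c.elim ∅ fun i => {en i}
      have hs' : ↑s' ⊆ N := by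
        rcases c with _ | i
        · simpa [s'] using hs
        · simpa [s', Set.insert_subset_iff] using ⟨hc i rfl, hs⟩
      have hcs' : c ∈ idx s' := by
        rcases c with _ | i
        · exact Set.mem_insert _ _
        · exact Set.mem_insert_of_mem _ ⟨i, by simp [s'], rfl⟩
      refine Set.Subset.trans ?_ (hN₁ s' hs')
      exact (Set.subset_biUnion_of_mem
        (u := fun t => insert (Sum.inl (r (C c) x)) (approxSet (pts (C c)) (r (C c) x) t))
        (Finset.mem_coe.2 (Finset.mem_powerset.2 Finset.subset_union_left))).trans
        (Set.subset_biUnion_of_mem (u := fun c => ⋃ t ∈ s'.powerset,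
          insert (Sum.inl (r (C c) x)) (approxSet (pts (C c)) (r (C c) x) t)) hcs')
    refine mem_closure_inter (h.separated N hNΦ) (h.mem_closure _ (hC c) x)
      (key ∅ (by simp) (Set.mem_insert _ _))
      fun s hs => (Set.subset_insert _ _).trans (key s hs)
  -- Every jump has its index in the small set `N`. If `en i ∉ N`, some stage `C c` above `i` has
  -- the same trace on `N` as something inside the hull below `i`; the point `r (C c) x` then lies
  -- in the closures for both hulls at `i` and equals both retracts.
  have hsub : {i | r (hull Φ (en '' Set.Iio i)) x ≠ r (hull Φ (en '' Set.Iic i)) x} ⊆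
      en ⁻¹' N := by
    intro i hi
    by_contra hiN
    apply hi
    suffices hc : ∃ c, (∀ j, c = some j → en j ∈ N) ∧ hull Φ (en '' Set.Iic i) ⊆ C c ∧
        C c ∩ N ⊆ hull Φ (en '' Set.Iio i) by
      obtain ⟨c, hcN, hic, hci⟩ := hc
      have hz := pts_mono hci (hCN c hcN)
      have hlow : hull Φ (en '' Set.Iio i) ⊆ hull Φ (en '' Set.Iic i) :=
        hull_mono (Set.image_mono Set.Iio_subset_Iic_self)
      rw [← h.eq_apply (isClosedUnder_hull _) hz fun f hf =>
          h.apply_eq _ (hC c) x f (hic (hlow hf)),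
        ← h.eq_apply (isClosedUnder_hull _) (pts_mono hlow hz) fun f hf =>
          h.apply_eq _ (hC c) x f (hic hf)]
    have hrkN : ∀ j, en j ∈ N → en (rk j) ∈ N := fun j hj =>
      hN₂ {en j} (by simpa using hj) ⟨j, by simp, rfl⟩
    have hlt : ∀ j, en j ∈ N → rk j < i → en j ∈ hull Φ (en '' Set.Iio i) := fun j _ hji =>
      hull_mono (Set.image_mono fun k hk => lt_of_le_of_lt hk hji) (hrk j)
    let S : Set I := {j | i < j ∧ en j ∈ N}
    have hne : ∀ j, en j ∈ N → j ≠ i := by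
      rintro j hj rfl
      exact hiN hj
    -- Take for `c` the least index of `N` above `i`, or the top stage if there is none. An element
    -- of `C c ∩ N` outside `hull Φ ∅` has its rank in `N` and below `c`, hence not above `i` and
    -- not equal to `i`.
    by_cases hS : S.Nonempty
    · let j₀ := (wellFounded_lt (α := I)).min S hS
      have hj₀ : j₀ ∈ S := WellFounded.min_mem _ S hS
      refine ⟨some j₀, ?_, hull_mono (Set.image_mono fun k hk => lt_of_le_of_lt hk hj₀.1), ?_⟩
      · rintro j ⟨⟩
        exact hj₀.2
      · rintro p ⟨hp, hpN⟩
        obtain ⟨j, rfl⟩ : p ∈ Set.range en :=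
          hull_subset (Set.image_subset_range _ _) hA hp
        obtain ⟨t, ht, hpt⟩ := exists_finset_of_mem_hull hp
        -- The rank is at most the largest index among finitely many generators. There may be no
        -- generators at all, since `Φ ∅` need not be empty.
        have hrj : rk j < j₀ ∨ en j ∈ hull Φ (∅ : Set (K ⊕ C(K, ℝ))) := by
          obtain ⟨t', ht', rfl⟩ := Finset.subset_set_image_iff.1 ht
          rcases t'.eq_empty_or_nonempty with rfl | hne'
          · right
            simpa using hpt
          · left
            refine lt_of_le_of_lt (hrk_le j (t'.max' hne') ?_) (ht' (t'.max'_mem hne'))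
            refine hull_mono ?_ hpt
            rw [Finset.coe_image]
            exact Set.image_mono fun k hk => t'.le_max' k hk
        rcases hrj with hrj | hrj
        · refine hlt j hpN (lt_of_le_of_ne ?_ (hne _ (hrkN j hpN)))
          by_contra hcon
          exact WellFounded.not_lt_min _ S (show rk j ∈ S from ⟨not_le.1 hcon, hrkN j hpN⟩) hrj
        · exact hull_mono (Set.empty_subset _) hrj
    · refine ⟨none, by simp, hull_subset (Set.image_subset_range _ _) hA, ?_⟩
      rintro _ ⟨⟨j, rfl⟩, hpN⟩
      refine hlt j hpN (lt_of_le_of_ne ?_ (hne _ (hrkN j hpN)))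
      by_contra hcon
      exact hS ⟨rk j, not_le.1 hcon, hrkN j hpN⟩
  refine (mk_le_mk_of_subset hsub).trans_lt ((mk_preimage_of_injective _ _ hen).trans_lt hNκ)

end RetractionSystem

end Retractions

/-! ### Small separating families, by induction on cardinality -/

section Families

variable {K : Type u} [TopologicalSpace K]

/-- A family of continuous functions factoring through `r A`, separating the points of
`closure (pts A)`, and with fewer than `κ` members not vanishing at any given point. -/
structure IsSmallFamily (κ : Cardinal.{u}) (r : Set (K ⊕ C(K, ℝ)) → C(K, K))
    (A : Set (K ⊕ C(K, ℝ))) (F : Set C(K, ℝ)) : Prop where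
  factors : ∀ f ∈ F, ∀ x, f (r A x) = f x
  separates : ∀ x ∈ closure (pts A), ∀ y ∈ closure (pts A), (∀ f ∈ F, f x = f y) → x = y
  mk_lt : ∀ x, #{f | f ∈ F ∧ f x ≠ 0} < κ

/-- Induction on `#A`. Below `κ` all functions of `A` serve. Otherwise `A` is the union of a chain
of smaller hulls, and the families of the stages are made to vanish off the jumps, of which each
point has fewer than `κ`. -/
theorem RetractionSystem.exists_isSmallFamily [CompactSpace K] {κ : Cardinal.{u}}
    {Φ : Finset (K ⊕ C(K, ℝ)) → Set (K ⊕ C(K, ℝ))} {r : Set (K ⊕ C(K, ℝ)) → C(K, K)}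
    (h : RetractionSystem κ Φ r) (hreg : κ.IsRegular) (hunc : ℵ₀ < κ)
    {A : Set (K ⊕ C(K, ℝ))} (hA : IsClosedUnder Φ A) : ∃ F, IsSmallFamily κ r A F := by
  induction hμ : #A using WellFoundedLT.induction generalizing A with
  | _ μ ih =>
  subst hμ
  have hfns : ∀ C : Set (K ⊕ C(K, ℝ)), #C < κ → #(fns C) < κ := fun C hC =>
    (mk_preimage_of_injective _ _ Sum.inr_injective).trans_lt hC
  rcases lt_or_ge #A κ with hAκ | hAκ
  · exact ⟨fns A, fun f hf x => h.apply_eq A hA x f hf, h.separated A hA,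
      fun x => (mk_le_mk_of_subset fun f hf => hf.1).trans_lt (hfns A hAκ)⟩
  -- A well-order of least possible type: proper initial segments, and hence the hulls `hi i`, have
  -- size `< #A`.
  obtain ⟨_, _, hord⟩ := exists_ord_eq_type_lt A
  let en : A → K ⊕ C(K, ℝ) := Subtype.val
  have hen : Function.Injective en := Subtype.val_injective
  have hrange : Set.range en = A := Subtype.range_coe
  let lo : A → Set (K ⊕ C(K, ℝ)) := fun i => hull Φ (en '' Set.Iio i)
  let hi : A → Set (K ⊕ C(K, ℝ)) := fun i => hull Φ (en '' Set.Iic i)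
  have hlo : ∀ i, IsClosedUnder Φ (lo i) := fun i => isClosedUnder_hull _
  have hhi : ∀ i, IsClosedUnder Φ (hi i) := fun i => isClosedUnder_hull _
  have hhiA : ∀ i, hi i ⊆ A := fun i =>
    hull_subset ((Set.image_subset_range _ _).trans hrange.subset) hA
  have hlohi : ∀ i, lo i ⊆ hi i := fun i => hull_mono (Set.image_mono Set.Iio_subset_Iic_self)
  have hloA : ∀ i, lo i ⊆ A := fun i => (hlohi i).trans (hhiA i)
  have hlt : ∀ i, #(hi i) < #A := fun i => by
    refine mk_hull_lt_of_le hreg hunc h.mk_lt hAκ (mk_image_le.trans_lt ?_)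
    rw [← Set.Iio_union_right]
    refine mk_union_lt (hreg.aleph0_le.trans hAκ) (mk_Iio_lt i hord) ?_
    rw [mk_singleton]
    exact one_lt_aleph0.trans_le (hreg.aleph0_le.trans hAκ)
  choose F hF using fun i => ih _ (hlt i) (hhi i) rfl
  have hjump : ∀ x, #{i | r (lo i) x ≠ r (hi i) x} < κ := fun x =>
    h.mk_jumps_lt hreg hunc hen (by rwa [hrange]) x
  -- The functions present before the chain starts are not covered by the differences `G i f` and
  -- are added separately.
  let base : Set C(K, ℝ) := fns (hull Φ ∅)
  have hbaseA : hull Φ ∅ ⊆ A := hull_subset (Set.empty_subset _) hA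
  have hbaseκ : #base < κ := hfns _ (mk_hull_lt hreg hunc h.mk_lt (by simpa using hreg.pos))
  let G : A → C(K, ℝ) → C(K, ℝ) := fun i f => f - f.comp (r (lo i))
  have hG : ∀ i f x, G i f x = f x - f (r (lo i) x) := fun i f x => rfl
  refine ⟨base ∪ ⋃ i, G i '' F i, ?_, ?_, ?_⟩
  · rintro f (hf | hf) x
    · exact h.apply_eq A hA x f (hbaseA hf)
    · obtain ⟨i, f, hfi, rfl⟩ := Set.mem_iUnion.1 hf
      rw [hG, hG, h.apply_apply hA (hlo i) (hloA i), ← (hF i).factors f hfi (r A x),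
        h.apply_apply hA (hhi i) (hhiA i), (hF i).factors f hfi]
  · intro x hx y hy hxy
    refine h.separated A hA x hx y hy ?_
    have hbase : ∀ f ∈ base, f x = f y := fun f hf => hxy f (Or.inl hf)
    -- Each function in `lo i` lies in `hull Φ ∅` or in an earlier `hi j`, so the retracts to `lo i`
    -- agree. Then equal values of `f - f ∘ r (lo i)` give `f x = f y` for all `f ∈ F i`.
    have key : ∀ i, r (hi i) x = r (hi i) y := by
      intro i
      induction i using WellFoundedLT.induction with
      | _ i IH =>
      have hloi : r (lo i) x = r (lo i) y := by
        refine h.eq_apply (hlo i) (h.mem_closure _ (hlo i) x) fun f hf => ?_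
        rw [h.apply_eq _ (hlo i) x f hf]
        obtain ⟨t, ht, hft⟩ := exists_finset_of_mem_hull hf
        classical
        obtain ⟨t', ht', rfl⟩ := Finset.subset_set_image_iff.1 ht
        rcases t'.eq_empty_or_nonempty with rfl | hne
        · exact hbase f (show Sum.inr f ∈ hull Φ ∅ by simpa using hft)
        · have hfi : f ∈ fns (hi (t'.max' hne)) := hull_mono (by
            rw [Finset.coe_image]
            exact Set.image_mono fun k hk => t'.le_max' k hk) hft
          rw [← h.apply_eq _ (hhi _) x f hfi, ← h.apply_eq _ (hhi _) y f hfi,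
            IH _ (ht' (t'.max'_mem hne))]
      refine (hF i).separates _ (h.mem_closure _ (hhi i) x) _ (h.mem_closure _ (hhi i) y)
        fun f hf => ?_
      have h1 := hxy (G i f) (Or.inr (Set.mem_iUnion.2 ⟨i, f, hf, rfl⟩))
      rw [hG, hG, hloi] at h1
      rw [(hF i).factors f hf, (hF i).factors f hf]
      exact sub_left_inj.1 h1
    intro f hf
    have hfi : f ∈ fns (hi ⟨Sum.inr f, hf⟩) := subset_hull _ ⟨⟨Sum.inr f, hf⟩, le_rfl, rfl⟩
    rw [← h.apply_eq _ (hhi _) x f hfi, ← h.apply_eq _ (hhi _) y f hfi, key]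
  · intro x
    let J : Set A := {i | r (lo i) x ≠ r (hi i) x}
    have hsub : {f | f ∈ base ∪ ⋃ i, G i '' F i ∧ f x ≠ 0} ⊆ base ∪ ⋃ i : J,
        G i '' ({f | f ∈ F i ∧ f x ≠ 0} ∪ {f | f ∈ F i ∧ f (r (lo i) x) ≠ 0}) := by
      rintro g ⟨hg | hg, hgx⟩
      · exact Or.inl hg
      · obtain ⟨i, f, hf, rfl⟩ := Set.mem_iUnion.1 hg
        have hne : f x ≠ f (r (lo i) x) := sub_ne_zero.1 hgx
        -- Without a jump at `i`, `f (r (lo i) x) = f (r (hi i) x) = f x`, so the difference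
        -- vanishes at `x`.
        have hiJ : i ∈ J := fun heq => hne (by rw [heq, (hF i).factors f hf])
        refine Or.inr (Set.mem_iUnion.2 ⟨⟨i, hiJ⟩, f, ?_, rfl⟩)
        by_cases hfx : f x = 0
        · exact Or.inr ⟨hf, fun h0 => hne (hfx.trans h0.symm)⟩
        · exact Or.inl ⟨hf, hfx⟩
    refine (mk_le_mk_of_subset hsub).trans_lt (mk_union_lt hreg.aleph0_le hbaseκ ?_)
    refine (card_iUnion_lt_iff_forall_of_isRegular hreg (hjump x)).2 fun i => ?_
    exact mk_image_le.trans_lt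
      (mk_union_lt hreg.aleph0_le ((hF i).mk_lt x) ((hF i).mk_lt _))

/-! ### Embedding into the `Σ_κ`-product -/

/-- A real number `t` is determined by the two numbers `max t 0 / (1 + |t|)` and
`max (-t) 0 / (1 + |t|)` of the unit interval. -/
noncomputable def signedPart (b : Bool) (t : ℝ) : unitInterval :=
  ⟨max (if b then t else -t) 0 / (1 + |t|), by positivity, by
    rw [div_le_one (by positivity)]
    rcases b <;> simp <;> constructor <;>
      first | positivity | linarith [neg_abs_le t, le_abs_self t]⟩

theorem continuous_signedPart (b : Bool) : Continuous (signedPart b) := by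
  refine Continuous.subtype_mk (Continuous.div ?_ (by fun_prop) fun t => by positivity) _
  rcases b <;> simp <;> fun_prop

theorem signedPart_zero (b : Bool) : signedPart b 0 = 0 := by
  apply Subtype.ext
  simp [signedPart]

theorem eq_of_signedPart_eq {s t : ℝ} (h : ∀ b, signedPart b s = signedPart b t) : s = t := by
  have h1 : max s 0 / (1 + |s|) = max t 0 / (1 + |t|) := by
    simpa [signedPart] using congrArg Subtype.val (h true)
  have h2 : max (-s) 0 / (1 + |s|) = max (-t) 0 / (1 + |t|) := by
    simpa [signedPart] using congrArg Subtype.val (h false)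
  have hs : 0 < 1 + |s| := by positivity
  have ht : 0 < 1 + |t| := by positivity
  rw [div_eq_div_iff hs.ne' ht.ne'] at h1 h2
  rcases le_total 0 s with h3 | h3 <;> rcases le_total 0 t with h4 | h4 <;>
    simp [abs_of_nonneg, abs_of_nonpos, h3, h4] at h1 h2 <;>
    first
      | nlinarith
      | (rcases h1 with h1 | h1 <;> rcases h2 with h2 | h2 <;> linarith)

theorem isKappaCorson_of_family [CompactSpace K] [T2Space K] {κ : Cardinal.{u}} (hκ : ℵ₀ ≤ κ)
    {F : Set C(K, ℝ)} (hsep : ∀ x y : K, (∀ f ∈ F, f x = f y) → x = y)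
    (hF : ∀ x, #{f | f ∈ F ∧ f x ≠ 0} < κ) : IsKappaCorson κ K := by
  have hmem : ∀ x : K, (fun p : F × Bool => signedPart p.2 (p.1.1 x)) ∈
      SigmaProduct κ (F × Bool) := by
    intro x
    -- Splitting values into two signed parts at most doubles the support, because zero goes to
    -- zero.
    let g : {p : F × Bool // signedPart p.2 (p.1.1 x) ≠ 0} → {f | f ∈ F ∧ f x ≠ 0} × Bool :=
      fun p => (⟨p.1.1.1, p.1.1.2, fun h0 => p.2 (by rw [h0, signedPart_zero])⟩, p.1.2)
    have hg : Function.Injective g := fun p q hpq => by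
      simp only [g, Prod.mk.injEq, Subtype.mk.injEq] at hpq
      exact Subtype.ext (Prod.ext (Subtype.ext hpq.1) hpq.2)
    refine (mk_le_of_injective hg).trans_lt ?_
    rw [mk_prod, lift_uzero]
    exact mul_lt_of_lt hκ (hF x) (by simpa using (natCast_lt_aleph0 (n := 2)).trans_le hκ)
  let φ : K → SigmaProduct κ (F × Bool) := fun x => ⟨_, hmem x⟩
  have hφ : Continuous φ := Continuous.subtype_mk
    (continuous_pi fun p : F × Bool => (continuous_signedPart p.2).comp p.1.1.continuous) _
  have hinj : Function.Injective φ := fun x y hxy => hsep x y fun f hf =>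
    eq_of_signedPart_eq fun b => congrFun (congrArg Subtype.val hxy) (⟨f, hf⟩, b)
  exact ⟨F × Bool, φ, (hφ.isClosedEmbedding hinj).isEmbedding⟩

theorem isKappaCorson_of_separated [CompactSpace K] [T2Space K] {κ : Cardinal.{u}}
    (hreg : κ.IsRegular) (hunc : ℵ₀ < κ)
    {Φ : Finset (K ⊕ C(K, ℝ)) → Set (K ⊕ C(K, ℝ))} (hΦ : ∀ s, #(Φ s) < κ)
    (hsep : ∀ A, IsClosedUnder Φ A → #A < κ → Separated A) : IsKappaCorson κ K := by
  obtain ⟨Ψ, r, h⟩ := exists_retractionSystem hreg hunc hΦ hsep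
  obtain ⟨F, hF⟩ := h.exists_isSmallFamily hreg hunc (A := Set.univ)
    fun _ _ => Set.subset_univ _
  have huniv : ∀ x : K, x ∈ closure (pts (Set.univ : Set (K ⊕ C(K, ℝ)))) := fun x =>
    subset_closure (Set.mem_univ _)
  exact isKappaCorson_of_family hreg.aleph0_le
    (fun x y => hF.separates x (huniv x) y (huniv y)) hF.mk_lt

end Families

/-! ### Codes -/

section CodeLemmas

theorem natCode_injective : Function.Injective natCode.{u} := fun m n h => by
  have := Ordinal.toZFSet_injective h
  exact_mod_cast this

/-- The formal fraction `(a - b) / c` as a set. -/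
noncomputable def fracCode (t : ℕ × ℕ × ℕ) : ZFSet.{u} :=
  ZFSet.pair (ZFSet.pair (natCode t.1) (natCode t.2.1)) (natCode t.2.2)

theorem fracCode_injective : Function.Injective fracCode.{u} := by
  rintro ⟨a, b, c⟩ ⟨a', b', c'⟩ h
  simp only [fracCode, ZFSet.pair_inj] at h
  rw [natCode_injective h.1.1, natCode_injective h.1.2, natCode_injective h.2]

/-- The value of a formal fraction. -/
noncomputable def fracVal (t : ℕ × ℕ × ℕ) : ℝ :=
  ((t.1 : ℝ) - t.2.1) / t.2.2

theorem mem_realCode {z : ZFSet.{u}} {r : ℝ} :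
    z ∈ realCode r ↔ ∃ t : ℕ × ℕ × ℕ, 0 < t.2.2 ∧ fracVal t < r ∧ fracCode t = z := by
  rw [realCode, ZFSet.mem_range]
  exact ⟨fun ⟨t, h⟩ => ⟨t.1, t.2.1, t.2.2, h⟩, fun ⟨t, h1, h2, h⟩ => ⟨⟨t, h1, h2⟩, h⟩⟩

theorem fracCode_mem_realCode {t : ℕ × ℕ × ℕ} {r : ℝ} (ht : 0 < t.2.2) :
    fracCode.{u} t ∈ realCode r ↔ fracVal t < r := by
  rw [mem_realCode]
  refine ⟨?_, fun h => ⟨t, ht, h, rfl⟩⟩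
  rintro ⟨t', -, h, h'⟩
  rwa [← fracCode_injective h']

theorem exists_fracVal_eq (q : ℚ) : ∃ t : ℕ × ℕ × ℕ, 0 < t.2.2 ∧ fracVal t = q := by
  refine ⟨(q.num.toNat, (-q.num).toNat, q.den), q.pos, ?_⟩
  have h : ((q.num.toNat : ℤ) : ℝ) - (((-q.num).toNat : ℤ) : ℝ) = q.num := by
    rw [← Int.cast_sub, Int.toNat_sub_toNat_neg]
  simp only [Int.cast_natCast] at h
  rw [fracVal, h]
  exact_mod_cast Rat.num_div_den q

theorem exists_fracVal_between {r r' : ℝ} (h : r < r') :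
    ∃ t : ℕ × ℕ × ℕ, 0 < t.2.2 ∧ r < fracVal t ∧ fracVal t < r' := by
  obtain ⟨q, h1, h2⟩ := exists_rat_btwn h
  obtain ⟨t, ht, hq⟩ := exists_fracVal_eq q
  exact ⟨t, ht, hq ▸ h1, hq ▸ h2⟩

theorem realCode_subset_realCode_iff {r r' : ℝ} :
    realCode.{u} r ⊆ realCode r' ↔ r ≤ r' := by
  refine ⟨fun h => not_lt.1 fun hlt => ?_, fun h z hz => ?_⟩
  · obtain ⟨t, ht, h1, h2⟩ := exists_fracVal_between hlt
    exact h1.not_gt ((fracCode_mem_realCode ht).1 (h ((fracCode_mem_realCode ht).2 h2)))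
  · obtain ⟨t, ht, hr, rfl⟩ := mem_realCode.1 hz
    exact (fracCode_mem_realCode ht).2 (hr.trans_le h)

theorem realCode_injective : Function.Injective realCode.{u} := fun _ _ h =>
  le_antisymm (realCode_subset_realCode_iff.1 h.subset)
    (realCode_subset_realCode_iff.1 h.symm.subset)

variable {K : Type u} (e : K ↪ ZFSet.{u})

theorem mem_subsetCode {A : Set K} {z : ZFSet.{u}} : z ∈ subsetCode e A ↔ ∃ x ∈ A, e x = z := by
  simp [subsetCode, ZFSet.mem_range]

theorem apply_mem_subsetCode {A : Set K} {x : K} : e x ∈ subsetCode e A ↔ x ∈ A := by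
  simp [mem_subsetCode]

theorem mem_funCode {f : K → ℝ} {z : ZFSet.{u}} :
    z ∈ funCode e f ↔ ∃ x, ZFSet.pair (e x) (realCode (f x)) = z := by
  rw [funCode, ZFSet.mem_range]

theorem pair_mem_funCode {f : K → ℝ} {x : K} {z : ZFSet.{u}} :
    ZFSet.pair (e x) z ∈ funCode e f ↔ z = realCode (f x) := by
  rw [mem_funCode]
  constructor
  · rintro ⟨y, hy⟩
    rw [ZFSet.pair_inj] at hy
    rw [← hy.2, e.injective hy.1]
  · rintro rfl
    exact ⟨x, rfl⟩

theorem funCode_injective : Function.Injective (funCode e) := fun f g h => by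
  ext x
  apply realCode_injective.{u}
  rw [← pair_mem_funCode e (f := g), ← h, pair_mem_funCode e]

end CodeLemmas

/-! ### Elementary submodels generated by points and functions -/

section Generated

/-- A single rank-initial segment `V` of the universe is a transitive set that includes all the
given sets, so any `θ` above its cardinality works. -/
theorem exists_forall_mem_H {ι : Type u} (g : ι → ZFSet.{u}) :
    ∃ θ₀ : Cardinal.{u}, ∀ θ, θ₀ ≤ θ → ∀ i, g i ∈ H θ := by
  let V := ZFSet.vonNeumann (ZFSet.range g).rank
  refine ⟨Order.succ V.card, fun θ hθ i => ⟨V, ZFSet.isTransitive_vonNeumann _, ?_,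
    (Order.lt_succ _).trans_le hθ⟩⟩
  exact ZFSet.isTransitive_vonNeumann _ _
    (ZFSet.subset_vonNeumann_self (ZFSet.range g) (ZFSet.mem_range_self i))

/-- The finitary operation on `H(θ)` whose closed sets are `κ`-stable elementary submodels. -/
def submodelOp (κ θ : Cardinal.{u}) [Nonempty (H θ)] (s : Finset (H θ)) : Set (H θ) :=
  (FirstOrder.Language.Substructure.closure (setLang.sum setLang.skolem₁) (s : Set (H θ)) :
      Set (H θ)) ∪
    ⋃ α : {α : s // (α.1 : ZFSet.{u}) ∈ κ.ord.toZFSet}, {β | (β : ZFSet.{u}) ∈ (α.1.1 : ZFSet.{u})}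

/-- The language is countable, so the Skolem hull of a finite set is countable; each of the finitely
many ordinals below `κ` has fewer than `κ` elements. `H θ` lives one universe up, whence the lifts.
-/
theorem mk_submodelOp_lt {κ θ : Cardinal.{u}} [Nonempty (H θ)] (hreg : κ.IsRegular)
    (hunc : ℵ₀ < κ) (s : Finset (H θ)) : #(submodelOp κ θ s) < Cardinal.lift.{u + 1} κ := by
  have hreg' : (Cardinal.lift.{u + 1} κ).IsRegular := hreg.lift
  have hunc' : ℵ₀ < Cardinal.lift.{u + 1} κ := by simpa using hunc
  refine mk_union_lt hreg'.aleph0_le ?_ ?_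
  · refine lt_of_le_of_lt ?_ hunc'
    have hcard : setLang.card ≤ ℵ₀ := by
      have : Countable setLang.Symbols := by
        have h1 : Countable (Σ n, setLang.Functions n) := by
          have : ∀ n, IsEmpty (setLang.Functions n) := fun n => inferInstanceAs (IsEmpty Empty)
          infer_instance
        have h2 : Countable (Σ n, setLang.Relations n) := by
          refine ⟨fun x => x.1, ?_⟩
          rintro ⟨_, ⟨⟩⟩ ⟨_, ⟨⟩⟩ _
          rfl
        exact instCountableSum
      exact mk_le_aleph0
    have h := FirstOrder.Language.Substructure.lift_card_closure_le
      (L := setLang.sum setLang.skolem₁) (s := (s : Set (H θ)))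
    have h2 := (FirstOrder.Language.card_functions_sum_skolem₁_le (L := setLang)).trans
      (max_le le_rfl hcard)
    simp only [lift_uzero] at h
    refine h.trans (max_le le_rfl ?_)
    refine (add_le_add (s.finite_toSet.countable.le_aleph0) (lift_le.2 h2)).trans ?_
    simp
  · refine (card_iUnion_lt_iff_forall_of_isRegular hreg' ?_).2 ?_
    · exact (lt_aleph0_of_finite _).trans hunc'
    · rintro ⟨α, hα⟩
      obtain ⟨a, ha, hαa⟩ := Ordinal.mem_toZFSet_iff.1 hα
      have hle : #{β : H θ | (β : ZFSet.{u}) ∈ (α.1 : ZFSet.{u})} ≤ #(α.1 : ZFSet.{u}) :=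
        mk_le_of_injective (f := fun β => ⟨β.1.1, β.2⟩) fun β γ h =>
          Subtype.ext (Subtype.ext (Subtype.mk.inj h))
      refine hle.trans_lt ?_
      rw [ZFSet.cardinalMk_coe_sort, lift_lt, ← hαa, Ordinal.card_toZFSet]
      exact lt_ord.1 ha

/-- A set closed under Skolem functions is the universe of an elementary substructure. -/
theorem exists_elementarySubstructure_of_isClosedUnder {κ θ : Cardinal.{u}} [Nonempty (H θ)]
    {C : Set (H θ)} (hC : IsClosedUnder (submodelOp κ θ) C) :
    ∃ M : setLang.ElementarySubstructure (H θ), ∀ y, y ∈ M ↔ y ∈ C := by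
  classical
  let S : (setLang.sum setLang.skolem₁).Substructure (H θ) :=
    { carrier := C
      fun_mem := fun {n} f x hx => by
        refine hC (Finset.univ.image x) (by simpa [Set.range_subset_iff] using hx) (Or.inl ?_)
        exact (FirstOrder.Language.Substructure.closure _ _).fun_mem f x fun i =>
          FirstOrder.Language.Substructure.subset_closure (by simp) }
  exact ⟨S.elementarySkolem₁Reduct, fun y => Iff.rfl⟩

end Generated

/-! ### Property `B(κ)` implies `κ`-Corson -/

theorem isKappaCorson_of_propertyB {κ : Cardinal.{u}} (hreg : κ.IsRegular) (hunc : ℵ₀ < κ)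
    {K : Type u} [TopologicalSpace K] [CompactSpace K] [T2Space K] {e : K ↪ ZFSet.{u}}
    (hB : PropertyB κ e) : IsKappaCorson κ K := by
  have hreg' : (Cardinal.lift.{u + 1} κ).IsRegular := hreg.lift
  have hunc' : ℵ₀ < Cardinal.lift.{u + 1} κ := by simpa using hunc
  obtain ⟨θ₀, hθ₀⟩ := hB
  let code : K ⊕ C(K, ℝ) → ZFSet.{u} := Sum.elim e fun f => funCode e f
  let par : Fin 3 → ZFSet.{u} :=
    ![κ.ord.toZFSet, subsetCode e Set.univ, familyCode e {U | IsOpen U}]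
  obtain ⟨θ₁, hθ₁⟩ := exists_forall_mem_H (Sum.elim code fun i : ULift.{u} (Fin 3) => par i.down)
  let θ := max θ₀ θ₁
  have hmem := hθ₁ θ (le_max_right _ _)
  let code' : K ⊕ C(K, ℝ) → H θ := fun p => ⟨code p, hmem (Sum.inl p)⟩
  let par' : Fin 3 → H θ := fun i => ⟨par i, hmem (Sum.inr ⟨i⟩)⟩
  have : Nonempty (H θ) := ⟨par' 0⟩
  let G : Set (K ⊕ C(K, ℝ)) → Set (H θ) := fun A =>
    hull (submodelOp κ θ) (code' '' A ∪ Set.range par')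
  have hGκ : ∀ A : Set (K ⊕ C(K, ℝ)), #A < κ → #(G A) < Cardinal.lift.{u + 1} κ := fun A hA => by
    refine mk_hull_lt hreg' hunc' (mk_submodelOp_lt hreg hunc) (mk_union_lt hreg'.aleph0_le ?_ ?_)
    · have h1 := mk_image_le_lift (f := code') (s := A)
      rw [lift_id'.{u, u + 1}] at h1
      exact h1.trans_lt (lift_lt.2 hA)
    · exact (Set.finite_range _).countable.le_aleph0.trans_lt hunc'
  -- `Φ s` is the trace on points and functions of the stable submodel generated by `s`, by `κ`, and
  -- by codes of `K` and its topology.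
  refine isKappaCorson_of_separated hreg hunc
    (Φ := fun s => {p | code' p ∈ G (s : Set (K ⊕ C(K, ℝ)))}) ?_ ?_
  · intro s
    have hs : #(G (s : Set (K ⊕ C(K, ℝ)))) < Cardinal.lift.{u + 1} κ :=
      hGκ _ (s.finite_toSet.countable.le_aleph0.trans_lt hunc)
    have hpre : ∀ {X : Type u} (g : X → H θ), Function.Injective g →
        #(g ⁻¹' G (s : Set (K ⊕ C(K, ℝ)))) < κ := fun g hg => by
      have h1 := mk_preimage_of_injective_lift g (G (s : Set (K ⊕ C(K, ℝ)))) hg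
      rw [lift_id'.{u, u + 1}] at h1
      exact lift_lt.1 (h1.trans_lt hs)
    have hsub : {p | code' p ∈ G (s : Set (K ⊕ C(K, ℝ)))} ⊆
        Sum.inl '' ((fun x => code' (Sum.inl x)) ⁻¹' G (s : Set (K ⊕ C(K, ℝ)))) ∪
        Sum.inr '' ((fun f => code' (Sum.inr f)) ⁻¹' G (s : Set (K ⊕ C(K, ℝ)))) := by
      rintro (x | f) hp
      · exact Or.inl ⟨x, hp, rfl⟩
      · exact Or.inr ⟨f, hp, rfl⟩
    refine (mk_le_mk_of_subset hsub).trans_lt (mk_union_lt hreg.aleph0_le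
      (mk_image_le.trans_lt (hpre _ fun x y h => ?_))
      (mk_image_le.trans_lt (hpre _ fun f g h => ?_)))
    · exact e.injective (congrArg Subtype.val h)
    · exact DFunLike.coe_injective (funCode_injective e (congrArg Subtype.val h))
  · intro A hA hAκ x hx y hy hxy
    -- The submodel generated by `A` has no further points or functions: membership in it already
    -- follows from a finite part of `A`, and `A` is closed under `Φ`. So `C(K) ∩ M` adds nothing to
    -- `fns A`.
    have htrace : ∀ p, code' p ∈ G A → p ∈ A := by
      classical
      intro p hp
      obtain ⟨t, ht, hpt⟩ := exists_finset_of_mem_hull hp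
      have hex : ∀ z : H θ, z ∈ t → ∃ s : Finset (K ⊕ C(K, ℝ)), ↑s ⊆ A ∧
          z ∈ code' '' (s : Set (K ⊕ C(K, ℝ))) ∪ Set.range par' := by
        intro z hz
        rcases ht hz with ⟨q, hq, rfl⟩ | hz
        · exact ⟨{q}, by simpa using hq, Or.inl ⟨q, by simp, rfl⟩⟩
        · exact ⟨∅, by simp, Or.inr hz⟩
      choose! g hgA hg using hex
      refine hA (t.biUnion g) (by simpa using hgA) (hull_mono (fun z hz => ?_) hpt)
      refine Set.union_subset_union_left _ (Set.image_mono ?_) (hg z hz)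
      exact Finset.coe_subset.2 (Finset.subset_biUnion_of_mem g hz)
    obtain ⟨M, hM⟩ := exists_elementarySubstructure_of_isClosedUnder
      (isClosedUnder_hull (Ψ := submodelOp κ θ) (code' '' A ∪ Set.range par'))
    have hel : ∀ z : H θ, (z : ZFSet.{u}) ∈ elems M ↔ z ∈ G A := fun z =>
      ⟨fun ⟨w, hw, hwz⟩ => by rw [← Subtype.ext hwz]; exact (hM w).1 hw,
        fun hz => ⟨z, (hM z).2 hz, rfl⟩⟩
    have hpar : ∀ i, par i ∈ elems M := fun i =>
      (hel (par' i)).2 (subset_hull _ (Or.inr ⟨i, rfl⟩))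
    have hpts : pts A ⊆ pointsIn e M := fun z hz =>
      (hel (code' (Sum.inl z))).2 (subset_hull _ (Or.inl ⟨_, hz, rfl⟩))
    refine hθ₀ θ (le_max_left _ _) M ⟨hpar 0, ?_⟩ ⟨hpar 1, _,
      TopologicalSpace.isTopologicalBasis_opens, hpar 2⟩ ?_ x (closure_mono hpts hx) y
      (closure_mono hpts hy) ?_
    -- Stability comes from the second half of `submodelOp`, which adds all elements of each ordinal
    -- below `κ`.
    · rintro _ hα ⟨α, hαM, rfl⟩ β hβ
      have hβH : β ∈ H θ := by
        obtain ⟨t, ht, hαt, htθ⟩ := α.2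
        exact ⟨t, ht, ht _ (hαt hβ), htθ⟩
      refine (hel ⟨β, hβH⟩).2 (isClosedUnder_hull _ {α} (by simpa using (hM α).1 hαM) (Or.inr ?_))
      exact Set.mem_iUnion.2 ⟨⟨⟨α, by simp⟩, hα⟩, hβ⟩
    · refine lt_of_le_of_lt ?_ (hGκ A hAκ)
      exact mk_le_mk_of_subset (s := {y | y ∈ M}) fun z hz => (hM z).1 hz
    · intro f hf
      exact hxy f (htrace (Sum.inr f) ((hel (code' (Sum.inr f))).1 hf))

/-! ### Definability with parameters from an elementary submodel

A predicate on sequences of sets is definable if, on `H(θ)`, it is given by a first-order formula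
with parameters from `M`. -/

section Definability

variable {θ : Cardinal.{u}} (M : setLang.ElementarySubstructure (H θ))

/-- The predicate `P` on sequences in `H(θ)` is first-order definable with parameters from `M`. -/
def Def (P : (ℕ → ZFSet.{u}) → Prop) : Prop :=
  ∃ φ : setLang.Formula (M ⊕ ℕ), ∀ v : ℕ → H θ,
    φ.Realize (Sum.elim (fun m : M => (m : H θ)) v) ↔ P fun i => v i

/-- `t` is a variable or a parameter from `M`. -/
def Var (t : (ℕ → ZFSet.{u}) → ZFSet.{u}) : Prop :=
  ∃ i : M ⊕ ℕ, ∀ v : ℕ → H θ,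
    t (fun j => v j) = ((Sum.elim (fun m : M => (m : H θ)) v i : H θ) : ZFSet.{u})

variable {M}

theorem Var.proj (i : ℕ) : Var M fun v => v i :=
  ⟨Sum.inr i, fun _ => rfl⟩

theorem Var.const {c : ZFSet.{u}} (hc : c ∈ elems M) : Var M fun _ => c := by
  obtain ⟨y, hy, rfl⟩ := hc
  exact ⟨Sum.inl ⟨y, hy⟩, fun _ => rfl⟩

theorem H_transitive {x y : ZFSet.{u}} (hx : x ∈ H θ) (hy : y ∈ x) : y ∈ H θ := by
  obtain ⟨t, ht, hxt, htθ⟩ := hx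
  exact ⟨t, ht, ht _ (hxt hy), htθ⟩

theorem mem_H_of_mem_elems {x : ZFSet.{u}} (hx : x ∈ elems M) : x ∈ H θ := by
  obtain ⟨y, -, rfl⟩ := hx
  exact y.2

variable {a b c d : (ℕ → ZFSet.{u}) → ZFSet.{u}} {P Q : (ℕ → ZFSet.{u}) → Prop}

theorem Var.mem_H (ha : Var M a) (v : ℕ → H θ) : a (fun i => v i) ∈ H θ := by
  obtain ⟨i, hi⟩ := ha
  rw [hi]
  exact Subtype.prop _

theorem Def.congr (hP : Def M P)
    (h : ∀ v : ℕ → H θ, Q (fun i => v i) ↔ P fun i => v i) : Def M Q := by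
  obtain ⟨φ, hφ⟩ := hP
  exact ⟨φ, fun v => (hφ v).trans (h v).symm⟩

/-- The membership symbol. -/
def memRel : setLang.Relations 2 :=
  SetRel.mem

theorem Def.mem (ha : Var M a) (hb : Var M b) : Def M fun v => a v ∈ b v := by
  obtain ⟨i, hi⟩ := ha
  obtain ⟨j, hj⟩ := hb
  refine ⟨memRel.formula₂
    (FirstOrder.Language.Term.var i) (FirstOrder.Language.Term.var j), fun v => ?_⟩
  rw [FirstOrder.Language.Formula.realize_rel₂]
  beta_reduce
  rw [hi, hj]
  rfl

theorem Def.eq (ha : Var M a) (hb : Var M b) : Def M fun v => a v = b v := by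
  obtain ⟨i, hi⟩ := ha
  obtain ⟨j, hj⟩ := hb
  refine ⟨FirstOrder.Language.Term.equal (FirstOrder.Language.Term.var i)
    (FirstOrder.Language.Term.var j), fun v => ?_⟩
  rw [FirstOrder.Language.Formula.realize_equal]
  beta_reduce
  rw [hi, hj]
  exact Subtype.ext_iff

theorem Def.not (hP : Def M P) : Def M fun v => ¬ P v := by
  obtain ⟨φ, hφ⟩ := hP
  exact ⟨φ.not, fun v => by rw [FirstOrder.Language.Formula.realize_not, hφ]⟩

theorem Def.imp (hP : Def M P) (hQ : Def M Q) : Def M fun v => P v → Q v := by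
  obtain ⟨φ, hφ⟩ := hP
  obtain ⟨ψ, hψ⟩ := hQ
  exact ⟨φ.imp ψ, fun v => by rw [FirstOrder.Language.Formula.realize_imp, hφ, hψ]⟩

theorem Def.and (hP : Def M P) (hQ : Def M Q) : Def M fun v => P v ∧ Q v :=
  (hP.imp hQ.not).not.congr fun v => by tauto

theorem Def.or (hP : Def M P) (hQ : Def M Q) : Def M fun v => P v ∨ Q v :=
  (hP.not.imp hQ).congr fun v => by tauto

/-- Variables are handled as de Bruijn indices: the quantified one is number `0` and the others
shift up by one. -/
theorem Def.ex {R : (ℕ → ZFSet.{u}) → ZFSet.{u} → Prop}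
    (hR : Def M fun w => R (fun n => w (n + 1)) (w 0)) : Def M fun v => ∃ x ∈ H θ, R v x := by
  obtain ⟨φ, hφ⟩ := hR
  let g : M ⊕ ℕ → (M ⊕ ℕ) ⊕ Fin 1 :=
    Sum.elim (fun m => Sum.inl (Sum.inl m)) fun n => n.casesOn (Sum.inr 0) fun n =>
      Sum.inl (Sum.inr n)
  refine ⟨(FirstOrder.Language.BoundedFormula.relabel (k := 0) g φ).ex, fun v => ?_⟩
  have key : ∀ x : H θ, (FirstOrder.Language.BoundedFormula.relabel (k := 0) g φ).Realize
      (Sum.elim (fun m : M => (m : H θ)) v) (Fin.snoc default x) ↔ R (fun i => v i) x := by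
    intro x
    rw [FirstOrder.Language.BoundedFormula.realize_relabel]
    have hv := hφ fun n => n.casesOn x v
    refine Iff.trans (iff_of_eq ?_) hv
    rw [FirstOrder.Language.Formula.Realize]
    congr 1
    · ext (m | _ | n) <;> rfl
    · exact Subsingleton.elim _ _
  rw [FirstOrder.Language.Formula.Realize, FirstOrder.Language.BoundedFormula.realize_ex]
  exact ⟨fun ⟨x, hx⟩ => ⟨x, x.2, (key x).1 hx⟩, fun ⟨x, hxH, hx⟩ => ⟨⟨x, hxH⟩, (key ⟨x, hxH⟩).2 hx⟩⟩

theorem Var.shift (ha : Var M a) : Var M fun w => a fun n => w (n + 1) := by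
  obtain ⟨i | i, hi⟩ := ha
  · exact ⟨Sum.inl i, fun v => hi fun n => v (n + 1)⟩
  · exact ⟨Sum.inr (i + 1), fun v => hi fun n => v (n + 1)⟩

/-- `H θ` is transitive, so a bounded quantifier over all sets means the same inside `H θ`. For this
reason the formulas below use bounded quantifiers almost exclusively. -/
theorem Def.bex {R : (ℕ → ZFSet.{u}) → ZFSet.{u} → Prop} (ha : Var M a)
    (hR : Def M fun w => R (fun n => w (n + 1)) (w 0)) : Def M fun v => ∃ x ∈ a v, R v x := by
  refine (Def.ex (R := fun v x => x ∈ a v ∧ R v x) ((Def.mem (Var.proj 0) ha.shift).and hR)).congr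
    fun v => ⟨?_, ?_⟩
  · rintro ⟨x, hxa, hx⟩
    exact ⟨x, H_transitive (ha.mem_H v) hxa, hxa, hx⟩
  · rintro ⟨x, -, hx⟩
    exact ⟨x, hx⟩

theorem Def.ball {R : (ℕ → ZFSet.{u}) → ZFSet.{u} → Prop} (ha : Var M a)
    (hR : Def M fun w => R (fun n => w (n + 1)) (w 0)) : Def M fun v => ∀ x ∈ a v, R v x :=
  (Def.bex (R := fun v x => ¬ R v x) ha hR.not).not.congr fun v => by
    push Not
    rfl

/-- This is the form in which elementarity is used: a definable property with a witness in `H θ` has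
one in `M`. -/
theorem exists_mem_elems {R : ZFSet.{u} → Prop} (hR : Def M fun v => R (v 0))
    (hex : ∃ x ∈ H θ, R x) : ∃ x ∈ elems M, R x := by
  obtain ⟨φ, hφ⟩ := hR
  -- Only variable `0` matters, so all variables are identified with the one to be quantified.
  let g : M ⊕ ℕ → M ⊕ Fin 1 := Sum.elim Sum.inl fun _ => Sum.inr 0
  let ψ : setLang.Formula M := (FirstOrder.Language.BoundedFormula.relabel (k := 0) g φ).ex
  have hψ : ψ.Realize (M.subtype ∘ id) := by
    obtain ⟨x, hxH, hx⟩ := hex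
    refine FirstOrder.Language.BoundedFormula.realize_ex.2 ⟨⟨x, hxH⟩, ?_⟩
    rw [FirstOrder.Language.BoundedFormula.realize_relabel]
    have hv := (hφ fun _ => ⟨x, hxH⟩).2 hx
    convert hv using 1
    rw [FirstOrder.Language.Formula.Realize]
    refine iff_of_eq ?_
    congr 1
    · ext (m | n) <;> rfl
    · exact Subsingleton.elim _ _
  rw [M.subtype.map_formula] at hψ
  obtain ⟨x, hx⟩ := FirstOrder.Language.BoundedFormula.realize_ex.1 hψ
  rw [FirstOrder.Language.BoundedFormula.realize_relabel] at hx
  have hx' : φ.Realize (Sum.elim id fun _ : ℕ => x) := by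
    convert hx using 1
    rw [FirstOrder.Language.Formula.Realize]
    refine iff_of_eq ?_
    congr 1
    · ext (m | n) <;> rfl
    · exact Subsingleton.elim _ _
  rw [← M.subtype.map_formula] at hx'
  refine ⟨x, ⟨x, x.2, rfl⟩, (hφ fun _ => x).1 ?_⟩
  convert hx' using 1
  ext (m | n) <;> rfl

theorem mem_elems_of_unique {R : ZFSet.{u} → Prop} (hR : Def M fun v => R (v 0)) {x : ZFSet.{u}}
    (hxH : x ∈ H θ) (hx : R x) (huniq : ∀ y, R y → y = x) : x ∈ elems M := by
  obtain ⟨y, hy, hRy⟩ := exists_mem_elems hR ⟨x, hxH, hx⟩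
  rwa [← huniq y hRy]

/-! #### Definability of basic notions of set theory -/

theorem Def.eq_empty (ha : Var M a) : Def M fun v => a v = ∅ := by
  refine Def.congr (P := fun v => ∀ x ∈ a v, ¬ x = x) ?_ fun v => ?_
  · exact Def.ball ha (Def.eq (Var.proj 0) (Var.proj 0)).not
  · simp [ZFSet.eq_empty]

theorem Def.eq_succ (ha : Var M a) (hb : Var M b) : Def M fun v => b v = insert (a v) (a v) := by
  refine Def.congr (P := fun v => a v ∈ b v ∧ (∀ x ∈ a v, x ∈ b v) ∧
    ∀ x ∈ b v, x = a v ∨ x ∈ a v) ?_ fun v => ?_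
  · refine (Def.mem ha hb).and ((Def.ball ha (Def.mem (Var.proj 0) hb.shift)).and (Def.ball hb ?_))
    exact (Def.eq (Var.proj 0) ha.shift).or (Def.mem (Var.proj 0) ha.shift)
  · constructor
    · intro h
      simp only [h, ZFSet.mem_insert_iff]
      exact ⟨Or.inl trivial, fun x => Or.inr, fun x => id⟩
    · rintro ⟨h1, h2, h3⟩
      ext z
      rw [ZFSet.mem_insert_iff]
      exact ⟨h3 z, fun h => h.elim (fun h => h ▸ h1) (h2 z)⟩

theorem Def.eq_unordered (ha : Var M a) (hb : Var M b) (hc : Var M c) :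
    Def M fun v => c v = {a v, b v} := by
  refine Def.congr (P := fun v => a v ∈ c v ∧ b v ∈ c v ∧ ∀ x ∈ c v, x = a v ∨ x = b v) ?_
    fun v => ?_
  · refine (Def.mem ha hc).and ((Def.mem hb hc).and (Def.ball hc ?_))
    exact (Def.eq (Var.proj 0) ha.shift).or (Def.eq (Var.proj 0) hb.shift)
  · constructor
    · intro h
      simp [h]
    · rintro ⟨h1, h2, h3⟩
      ext z
      rw [ZFSet.mem_pair]
      exact ⟨h3 z, fun h => h.elim (fun h => h ▸ h1) fun h => h ▸ h2⟩

theorem Def.eq_pair (ha : Var M a) (hb : Var M b) (hc : Var M c) :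
    Def M fun v => c v = ZFSet.pair (a v) (b v) := by
  refine Def.congr (P := fun v => ∃ x ∈ c v, ∃ y ∈ c v, x = {a v, a v} ∧ y = {a v, b v} ∧
    c v = {x, y}) ?_ fun v => ?_
  · refine Def.bex hc (Def.bex hc.shift ?_)
    refine (Def.eq_unordered ha.shift.shift ha.shift.shift (Var.proj 1)).and ?_
    exact (Def.eq_unordered ha.shift.shift hb.shift.shift (Var.proj 0)).and
      (Def.eq_unordered (Var.proj 1) (Var.proj 0) hc.shift.shift)
  · have hs : ∀ x : ZFSet.{u}, ({x, x} : ZFSet.{u}) = {x} := fun x => by ext; simp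
    constructor
    · intro h
      refine ⟨{a fun i => v i, a fun i => v i}, ?_, {a fun i => v i, b fun i => v i},
        ?_, rfl, rfl, ?_⟩ <;>
        rw [h, ZFSet.pair] <;> simp [hs]
    · rintro ⟨x, -, y, -, rfl, rfl, h⟩
      rw [h, hs, ZFSet.pair]

theorem Def.pair_mem (ha : Var M a) (hb : Var M b) (hc : Var M c) :
    Def M fun v => ZFSet.pair (a v) (b v) ∈ c v := by
  refine Def.congr (P := fun v => ∃ p ∈ c v, p = ZFSet.pair (a v) (b v)) ?_ fun v => by simp
  exact Def.bex hc (Def.eq_pair ha.shift hb.shift (Var.proj 0))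

/-- The components of a Kuratowski pair lie two membership levels down, so they can be reached by
bounded quantifiers. -/
theorem mem_pair_right (x y : ZFSet.{u}) : ∃ s ∈ ZFSet.pair x y, y ∈ s :=
  ⟨{x, y}, by simp [ZFSet.pair], by simp⟩

theorem mem_pair_left (x y : ZFSet.{u}) : ∃ s ∈ ZFSet.pair x y, x ∈ s :=
  ⟨{x, y}, by simp [ZFSet.pair], by simp⟩

theorem Def.eq_triple (ha : Var M a) (hb : Var M b) (hc : Var M c) (hd : Var M d) :
    Def M fun v => d v = ZFSet.pair (ZFSet.pair (a v) (b v)) (c v) := by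
  refine Def.congr (P := fun v => ∃ s ∈ d v, ∃ q ∈ s, q = ZFSet.pair (a v) (b v) ∧
    d v = ZFSet.pair q (c v)) ?_ fun v => ?_
  · refine Def.bex hd (Def.bex (Var.proj 0) ?_)
    exact (Def.eq_pair ha.shift.shift hb.shift.shift (Var.proj 0)).and
      (Def.eq_pair (Var.proj 0) hc.shift.shift hd.shift.shift)
  · constructor
    · intro h
      obtain ⟨s, hs, hq⟩ := mem_pair_left (ZFSet.pair (a fun i => v i) (b fun i => v i))
        (c fun i => v i)
      exact ⟨s, h ▸ hs, _, hq, rfl, h⟩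
    · rintro ⟨s, -, q, -, rfl, h⟩
      exact h

theorem Def.triple_mem (ha : Var M a) (hb : Var M b) (hc : Var M c) (hd : Var M d) :
    Def M fun v => ZFSet.pair (ZFSet.pair (a v) (b v)) (c v) ∈ d v := by
  refine Def.congr (P := fun v => ∃ p ∈ d v, p = ZFSet.pair (ZFSet.pair (a v) (b v)) (c v)) ?_
    fun v => by simp
  exact Def.bex hd (Def.eq_triple ha.shift hb.shift hc.shift (Var.proj 0))

end Definability

/-! ### Arithmetic in elementary submodels -/

section Arithmetic

variable {θ : Cardinal.{u}} {M : setLang.ElementarySubstructure (H θ)}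

/-- Lets a notion shown definable once be used as an atomic formula later. -/
theorem Def.subst {P : (ℕ → ZFSet.{u}) → Prop} (hP : Def M P)
    {t : ℕ → (ℕ → ZFSet.{u}) → ZFSet.{u}} (ht : ∀ i, Var M (t i)) :
    Def M fun v => P fun i => t i v := by
  obtain ⟨φ, hφ⟩ := hP
  choose j hj using ht
  let g : M ⊕ ℕ → M ⊕ ℕ := Sum.elim Sum.inl j
  refine ⟨φ.relabel g, fun v => ?_⟩
  rw [FirstOrder.Language.Formula.realize_relabel]
  have h := hφ fun i => Sum.elim (fun m : M => (m : H θ)) v (j i)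
  beta_reduce
  simp only [hj]
  rw [← h]
  refine iff_of_eq ?_
  congr 1
  ext (m | n) <;> rfl

theorem Def.subst₁ {R : ZFSet.{u} → Prop} (hR : Def M fun v => R (v 0))
    {a : (ℕ → ZFSet.{u}) → ZFSet.{u}} (ha : Var M a) : Def M fun v => R (a v) :=
  hR.subst (t := fun _ => a) fun _ => ha

theorem Def.subst₂ {R : ZFSet.{u} → ZFSet.{u} → Prop} (hR : Def M fun v => R (v 0) (v 1))
    {a b : (ℕ → ZFSet.{u}) → ZFSet.{u}} (ha : Var M a) (hb : Var M b) :
    Def M fun v => R (a v) (b v) :=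
  hR.subst (t := fun i => Nat.casesOn i a fun _ => b) fun i => by
    rcases i with _ | i
    exacts [ha, hb]

theorem Def.subst₃ {R : ZFSet.{u} → ZFSet.{u} → ZFSet.{u} → Prop}
    (hR : Def M fun v => R (v 0) (v 1) (v 2))
    {a b c : (ℕ → ZFSet.{u}) → ZFSet.{u}} (ha : Var M a) (hb : Var M b) (hc : Var M c) :
    Def M fun v => R (a v) (b v) (c v) :=
  hR.subst (t := fun i => Nat.casesOn i a fun i => Nat.casesOn i b fun _ => c) fun i => by
    rcases i with _ | _ | i
    exacts [ha, hb, hc]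

/-- The set of natural numbers. -/
noncomputable def omegaCode : ZFSet.{u} :=
  ZFSet.range natCode.{u}

theorem mem_omegaCode {z : ZFSet.{u}} : z ∈ omegaCode ↔ ∃ n, natCode n = z :=
  ZFSet.mem_range

theorem natCode_mem_omegaCode (n : ℕ) : natCode.{u} n ∈ omegaCode :=
  mem_omegaCode.2 ⟨n, rfl⟩

theorem natCode_zero : natCode.{u} 0 = ∅ := by
  simp [natCode]

theorem natCode_succ (n : ℕ) : natCode.{u} (n + 1) = insert (natCode n) (natCode n) := by
  rw [natCode, Nat.cast_succ, Ordinal.toZFSet_add_one]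
  rfl

theorem natCode_mem_natCode {m n : ℕ} : natCode.{u} m ∈ natCode n ↔ m < n := by
  rw [natCode, natCode, Ordinal.toZFSet_mem_toZFSet_iff]
  exact_mod_cast Iff.rfl

theorem exists_mem_omegaCode {P : ZFSet.{u} → Prop} :
    (∃ z ∈ omegaCode, P z) ↔ ∃ n, P (natCode n) := by
  simp [mem_omegaCode]

theorem forall_mem_omegaCode {P : ZFSet.{u} → Prop} :
    (∀ z ∈ omegaCode, P z) ↔ ∀ n, P (natCode n) := by
  simp [mem_omegaCode]

theorem empty_mem_elems (h : ∅ ∈ H θ) : ∅ ∈ elems M :=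
  mem_elems_of_unique (R := fun z => z = ∅) (Def.eq_empty (Var.proj 0)) h rfl fun _ h => h

/-- `ω` is the only set that contains `∅`, is closed under successor, and has only `∅` and
successors of its own elements as elements; by foundation nothing nonstandard satisfies the last
clause. -/
theorem omegaCode_mem_elems (h : omegaCode ∈ H θ) : omegaCode ∈ elems M := by
  refine mem_elems_of_unique (R := fun w => (∃ z ∈ w, z = ∅) ∧
    (∀ x ∈ w, ∃ y ∈ w, y = insert x x) ∧ ∀ x ∈ w, x = ∅ ∨ ∃ y ∈ w, x = insert y y) ?_ h ?_ ?_
  · repeat' first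
      | exact Var.proj _
      | apply Def.and | apply Def.or | apply Def.bex | apply Def.ball
      | apply Def.eq_empty | apply Def.eq_succ
  · simp only [exists_mem_omegaCode, forall_mem_omegaCode]
    refine ⟨⟨0, natCode_zero⟩, fun n => ⟨n + 1, natCode_succ n⟩, fun n => ?_⟩
    rcases n with _ | n
    · exact Or.inl natCode_zero
    · exact Or.inr ⟨n, natCode_succ n⟩
  · rintro w ⟨⟨_, h0, rfl⟩, hsucc, hpred⟩
    ext z
    rw [mem_omegaCode]
    constructor
    · intro hz
      induction z using ZFSet.inductionOn with
      | _ z ih =>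
      rcases hpred z hz with rfl | ⟨y, hy, rfl⟩
      · exact ⟨0, natCode_zero⟩
      · obtain ⟨n, rfl⟩ := ih y (by simp) hy
        exact ⟨n + 1, natCode_succ n⟩
    · rintro ⟨n, rfl⟩
      induction n with
      | zero => rwa [natCode_zero]
      | succ n ih =>
        obtain ⟨_, hy, rfl⟩ := hsucc _ ih
        rwa [natCode_succ]

/-- The graph of a binary operation on the natural numbers. -/
noncomputable def opCode (op : ℕ → ℕ → ℕ) : ZFSet.{u} :=
  ZFSet.range fun p : ℕ × ℕ => fracCode.{u} (p.1, p.2, op p.1 p.2)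

theorem triple_mem_opCode {op : ℕ → ℕ → ℕ} {n m l : ℕ} :
    ZFSet.pair (ZFSet.pair (natCode.{u} n) (natCode m)) (natCode l) ∈ opCode op ↔ l = op n m := by
  rw [opCode, ZFSet.mem_range]
  constructor
  · rintro ⟨p, hp⟩
    have := fracCode_injective (a₂ := (n, m, l)) hp
    simp only [Prod.mk.injEq] at this
    obtain ⟨rfl, rfl, rfl⟩ := this
    rfl
  · rintro rfl
    exact ⟨(n, m), rfl⟩

/-- A single-valued relation on `ω` that includes the graph of a total operation equals it. Addition
and multiplication are thereby pinned down by their recursion equations. -/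
theorem eq_opCode {op : ℕ → ℕ → ℕ} {A : ZFSet.{u}}
    (hfun : ∀ n ∈ omegaCode, ∀ m ∈ omegaCode, ∀ l ∈ omegaCode, ∀ l' ∈ omegaCode,
      ZFSet.pair (ZFSet.pair n m) l ∈ A → ZFSet.pair (ZFSet.pair n m) l' ∈ A → l = l')
    (hsub : ∀ p ∈ A, ∃ n ∈ omegaCode, ∃ m ∈ omegaCode, ∃ l ∈ omegaCode,
      p = ZFSet.pair (ZFSet.pair n m) l)
    (hop : ∀ n m, ZFSet.pair (ZFSet.pair (natCode n) (natCode m)) (natCode (op n m)) ∈ A) :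
    A = opCode op := by
  ext p
  constructor
  · intro hp
    obtain ⟨n, hn, m, hm, l, hl, rfl⟩ := hsub p hp
    obtain ⟨n, rfl⟩ := mem_omegaCode.1 hn
    obtain ⟨m, rfl⟩ := mem_omegaCode.1 hm
    rw [hfun _ hn _ hm _ hl _ (natCode_mem_omegaCode _) hp (hop n m), triple_mem_opCode]
  · intro hp
    obtain ⟨⟨n, m⟩, rfl⟩ := ZFSet.mem_range.1 hp
    exact hop n m

theorem addCode_mem_elems (h0 : ∅ ∈ elems M) (hω : omegaCode ∈ elems M)
    (h : opCode (· + ·) ∈ H θ) : opCode (· + ·) ∈ elems M := by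
  refine mem_elems_of_unique (R := fun A =>
    (∀ n ∈ omegaCode, ∀ m ∈ omegaCode, ∀ l ∈ omegaCode, ∀ l' ∈ omegaCode,
      ZFSet.pair (ZFSet.pair n m) l ∈ A → ZFSet.pair (ZFSet.pair n m) l' ∈ A → l = l') ∧
    (∀ p ∈ A, ∃ n ∈ omegaCode, ∃ m ∈ omegaCode, ∃ l ∈ omegaCode,
      p = ZFSet.pair (ZFSet.pair n m) l) ∧
    (∀ n ∈ omegaCode, ZFSet.pair (ZFSet.pair n ∅) n ∈ A) ∧
    ∀ n ∈ omegaCode, ∀ m ∈ omegaCode, ∀ l ∈ omegaCode, ∀ m' ∈ omegaCode, ∀ l' ∈ omegaCode,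
      m' = insert m m → l' = insert l l → ZFSet.pair (ZFSet.pair n m) l ∈ A →
        ZFSet.pair (ZFSet.pair n m') l' ∈ A) ?_ h ?_ ?_
  · repeat' first
      | exact Var.proj _ | exact Var.const h0 | exact Var.const hω
      | apply Def.and | apply Def.bex | apply Def.ball
      | apply Def.eq_triple | apply Def.triple_mem | apply Def.eq_succ
      | apply Def.imp | apply Def.eq
  · simp only [forall_mem_omegaCode, exists_mem_omegaCode, ← natCode_zero, ← natCode_succ,
      triple_mem_opCode, natCode_injective.eq_iff]
    refine ⟨?_, ?_, ?_, ?_⟩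
    · rintro n m l l' rfl rfl
      rfl
    · intro p hp
      obtain ⟨⟨n, m⟩, rfl⟩ := ZFSet.mem_range.1 hp
      exact ⟨n, m, n + m, rfl⟩
    · intro n
      rfl
    · rintro n m l m' l' rfl rfl rfl
      rfl
  · rintro A ⟨hfun, hsub, hzero, hsucc⟩
    refine eq_opCode hfun hsub fun n m => ?_
    induction m with
    | zero => rw [natCode_zero]; exact hzero _ (natCode_mem_omegaCode n)
    | succ m ih =>
      exact hsucc _ (natCode_mem_omegaCode n) _ (natCode_mem_omegaCode m) _
        (natCode_mem_omegaCode _) _ (natCode_mem_omegaCode _) _ (natCode_mem_omegaCode _)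
        (natCode_succ m) (natCode_succ (n + m)) ih

theorem mulCode_mem_elems (h0 : ∅ ∈ elems M) (hω : omegaCode ∈ elems M)
    (hadd : opCode (· + ·) ∈ elems M) (h : opCode (· * ·) ∈ H θ) :
    opCode (· * ·) ∈ elems M := by
  refine mem_elems_of_unique (R := fun A =>
    (∀ n ∈ omegaCode, ∀ m ∈ omegaCode, ∀ l ∈ omegaCode, ∀ l' ∈ omegaCode,
      ZFSet.pair (ZFSet.pair n m) l ∈ A → ZFSet.pair (ZFSet.pair n m) l' ∈ A → l = l') ∧
    (∀ p ∈ A, ∃ n ∈ omegaCode, ∃ m ∈ omegaCode, ∃ l ∈ omegaCode,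
      p = ZFSet.pair (ZFSet.pair n m) l) ∧
    (∀ n ∈ omegaCode, ZFSet.pair (ZFSet.pair n ∅) ∅ ∈ A) ∧
    ∀ n ∈ omegaCode, ∀ m ∈ omegaCode, ∀ l ∈ omegaCode, ∀ m' ∈ omegaCode, ∀ l' ∈ omegaCode,
      m' = insert m m → ZFSet.pair (ZFSet.pair l n) l' ∈ opCode (· + ·) →
        ZFSet.pair (ZFSet.pair n m) l ∈ A → ZFSet.pair (ZFSet.pair n m') l' ∈ A) ?_ h ?_ ?_
  · repeat' first
      | exact Var.proj _ | exact Var.const h0 | exact Var.const hω | exact Var.const hadd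
      | apply Def.and | apply Def.bex | apply Def.ball
      | apply Def.eq_triple | apply Def.triple_mem | apply Def.eq_succ
      | apply Def.imp | apply Def.eq
  · simp only [forall_mem_omegaCode, exists_mem_omegaCode, ← natCode_zero, ← natCode_succ,
      triple_mem_opCode, natCode_injective.eq_iff]
    refine ⟨?_, ?_, ?_, ?_⟩
    · rintro n m l l' rfl rfl
      rfl
    · intro p hp
      obtain ⟨⟨n, m⟩, rfl⟩ := ZFSet.mem_range.1 hp
      exact ⟨n, m, n * m, rfl⟩
    · intro n
      rfl
    · rintro n m l m' l' rfl rfl rfl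
      rfl
  · rintro A ⟨hfun, hsub, hzero, hsucc⟩
    refine eq_opCode hfun hsub fun n m => ?_
    induction m with
    | zero => rw [Nat.mul_zero, natCode_zero]; exact hzero _ (natCode_mem_omegaCode n)
    | succ m ih =>
      exact hsucc _ (natCode_mem_omegaCode n) _ (natCode_mem_omegaCode m) _
        (natCode_mem_omegaCode _) _ (natCode_mem_omegaCode _) _ (natCode_mem_omegaCode _)
        (natCode_succ m) (triple_mem_opCode.2 rfl) ih

/-- The set of formal fractions with positive denominator. -/
noncomputable def ratCode : ZFSet.{u} :=
  ZFSet.range fun t : {t : ℕ × ℕ × ℕ // 0 < t.2.2} => fracCode.{u} t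

theorem mem_ratCode {z : ZFSet.{u}} :
    z ∈ ratCode ↔ ∃ t : ℕ × ℕ × ℕ, 0 < t.2.2 ∧ fracCode t = z := by
  rw [ratCode, ZFSet.mem_range]
  exact ⟨fun ⟨t, h⟩ => ⟨t.1, t.2, h⟩, fun ⟨t, ht, h⟩ => ⟨⟨t, ht⟩, h⟩⟩

theorem fracCode_mem_ratCode {t : ℕ × ℕ × ℕ} : fracCode.{u} t ∈ ratCode ↔ 0 < t.2.2 := by
  rw [mem_ratCode]
  refine ⟨?_, fun h => ⟨t, h, rfl⟩⟩
  rintro ⟨t', h, h'⟩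
  rwa [← fracCode_injective h']

theorem ratCode_mem_elems (h0 : ∅ ∈ elems M) (hω : omegaCode ∈ elems M)
    (h : ratCode ∈ H θ) : ratCode ∈ elems M := by
  have hpos : ∀ n : ℕ, ¬ n = 0 ↔ 0 < n := fun n => Nat.pos_iff_ne_zero.symm
  refine mem_elems_of_unique (R := fun q =>
    (∀ t ∈ q, ∃ a ∈ omegaCode, ∃ b ∈ omegaCode, ∃ c ∈ omegaCode, ¬ c = ∅ ∧
      t = ZFSet.pair (ZFSet.pair a b) c) ∧
    ∀ a ∈ omegaCode, ∀ b ∈ omegaCode, ∀ c ∈ omegaCode, ¬ c = ∅ →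
      ZFSet.pair (ZFSet.pair a b) c ∈ q) ?_ h ?_ ?_
  · repeat' first
      | exact Var.proj _ | exact Var.const h0 | exact Var.const hω
      | apply Def.and | apply Def.bex | apply Def.ball | apply Def.not
      | apply Def.eq_triple | apply Def.triple_mem | apply Def.imp | apply Def.eq
  · simp only [forall_mem_omegaCode, exists_mem_omegaCode, ← natCode_zero,
      natCode_injective.eq_iff, hpos]
    refine ⟨fun t ht => ?_, fun a b c hc => fracCode_mem_ratCode (t := (a, b, c)).2 hc⟩
    obtain ⟨⟨a, b, c⟩, hc, rfl⟩ := mem_ratCode.1 ht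
    exact ⟨a, b, c, hc, rfl⟩
  · simp only [forall_mem_omegaCode, exists_mem_omegaCode, ← natCode_zero,
      natCode_injective.eq_iff, hpos]
    rintro q ⟨h1, h2⟩
    ext z
    rw [mem_ratCode]
    constructor
    · intro hz
      obtain ⟨a, b, c, hc, rfl⟩ := h1 z hz
      exact ⟨(a, b, c), hc, rfl⟩
    · rintro ⟨⟨a, b, c⟩, hc, rfl⟩
      exact h2 a b c hc

/-- The strict order on formal fractions. -/
noncomputable def ltCode : ZFSet.{u} :=
  ZFSet.range fun p : {p : (ℕ × ℕ × ℕ) × (ℕ × ℕ × ℕ) //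
      0 < p.1.2.2 ∧ 0 < p.2.2.2 ∧ fracVal p.1 < fracVal p.2} =>
    ZFSet.pair (fracCode.{u} p.1.1) (fracCode p.1.2)

theorem pair_mem_ltCode {t t' : ℕ × ℕ × ℕ} (ht : 0 < t.2.2) (ht' : 0 < t'.2.2) :
    ZFSet.pair (fracCode.{u} t) (fracCode t') ∈ ltCode ↔ fracVal t < fracVal t' := by
  rw [ltCode, ZFSet.mem_range]
  constructor
  · rintro ⟨⟨p, h1, h2, h3⟩, hp⟩
    rw [ZFSet.pair_inj] at hp
    rwa [← fracCode_injective hp.1, ← fracCode_injective hp.2]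
  · intro h
    exact ⟨⟨(t, t'), ht, ht', h⟩, rfl⟩

/-- Cross-multiplying and moving the negative terms expresses the order with natural numbers only.
-/
theorem fracVal_lt_iff {a b c a' b' c' : ℕ} (hc : 0 < c) (hc' : 0 < c') :
    fracVal (a, b, c) < fracVal (a', b', c') ↔ a * c' + b' * c < a' * c + b * c' := by
  have h1 : (0 : ℝ) < c := by exact_mod_cast hc
  have h2 : (0 : ℝ) < c' := by exact_mod_cast hc'
  simp only [fracVal]
  rw [div_lt_div_iff₀ h1 h2, ← Nat.cast_lt (α := ℝ)]
  push_cast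
  constructor <;> intro h <;> nlinarith

theorem ltCode_mem_elems (hω : omegaCode ∈ elems M) (hadd : opCode (· + ·) ∈ elems M)
    (hmul : opCode (· * ·) ∈ elems M) (hq : ratCode ∈ elems M)
    (h : ltCode ∈ H θ) : ltCode ∈ elems M := by
  let LT : ZFSet.{u} → ZFSet.{u} → Prop := fun t t' =>
    ∃ a ∈ omegaCode, ∃ b ∈ omegaCode, ∃ c ∈ omegaCode, t = ZFSet.pair (ZFSet.pair a b) c ∧
    ∃ a' ∈ omegaCode, ∃ b' ∈ omegaCode, ∃ c' ∈ omegaCode, t' = ZFSet.pair (ZFSet.pair a' b') c' ∧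
    ∃ p ∈ omegaCode, ZFSet.pair (ZFSet.pair a c') p ∈ opCode (· * ·) ∧
    ∃ q ∈ omegaCode, ZFSet.pair (ZFSet.pair b' c) q ∈ opCode (· * ·) ∧
    ∃ p' ∈ omegaCode, ZFSet.pair (ZFSet.pair a' c) p' ∈ opCode (· * ·) ∧
    ∃ q' ∈ omegaCode, ZFSet.pair (ZFSet.pair b c') q' ∈ opCode (· * ·) ∧
    ∃ s ∈ omegaCode, ZFSet.pair (ZFSet.pair p q) s ∈ opCode (· + ·) ∧
    ∃ s' ∈ omegaCode, ZFSet.pair (ZFSet.pair p' q') s' ∈ opCode (· + ·) ∧ s ∈ s'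
  have hLTdef : Def M fun v => LT (v 0) (v 1) := by
    repeat' first
      | exact Var.proj _ | exact Var.const hω | exact Var.const hadd | exact Var.const hmul
      | apply Def.and | apply Def.bex
      | apply Def.eq_triple | apply Def.triple_mem | apply Def.mem
  have hLT : ∀ t t' : ℕ × ℕ × ℕ, 0 < t.2.2 → 0 < t'.2.2 →
      (LT (fracCode t) (fracCode t') ↔ fracVal t < fracVal t') := by
    rintro ⟨a, b, c⟩ ⟨a', b', c'⟩ hc hc'
    rw [fracVal_lt_iff hc hc']
    simp only [LT, exists_mem_omegaCode, triple_mem_opCode, natCode_mem_natCode,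
      exists_eq_left]
    constructor
    · rintro ⟨a₁, b₁, c₁, h₁, a₂, b₂, c₂, h₂, hlt⟩
      have h₁ := fracCode_injective (a₂ := (a₁, b₁, c₁)) h₁
      have h₂ := fracCode_injective (a₂ := (a₂, b₂, c₂)) h₂
      simp only [Prod.mk.injEq] at h₁ h₂
      obtain ⟨rfl, rfl, rfl⟩ := h₁
      obtain ⟨rfl, rfl, rfl⟩ := h₂
      exact hlt
    · intro hlt
      exact ⟨a, b, c, rfl, a', b', c', rfl, hlt⟩
  clear_value LT
  refine mem_elems_of_unique (R := fun L =>
    (∀ p ∈ L, ∃ t ∈ ratCode, ∃ t' ∈ ratCode, p = ZFSet.pair t t' ∧ LT t t') ∧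
    ∀ t ∈ ratCode, ∀ t' ∈ ratCode, LT t t' → ZFSet.pair t t' ∈ L) ?_ h ?_ ?_
  · repeat' first
      | exact Var.proj _ | exact Var.const hq
      | apply Def.and | apply Def.bex | apply Def.ball
      | apply Def.eq_pair | apply Def.pair_mem | apply hLTdef.subst₂ | apply Def.imp
  · constructor
    · intro p hp
      obtain ⟨⟨p, h1, h2, h3⟩, rfl⟩ := ZFSet.mem_range.1 hp
      exact ⟨_, fracCode_mem_ratCode.2 h1, _, fracCode_mem_ratCode.2 h2, rfl, (hLT _ _ h1 h2).2 h3⟩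
    · intro t ht t' ht' hlt
      obtain ⟨t, h1, rfl⟩ := mem_ratCode.1 ht
      obtain ⟨t', h2, rfl⟩ := mem_ratCode.1 ht'
      exact (pair_mem_ltCode h1 h2).2 ((hLT _ _ h1 h2).1 hlt)
  · rintro L ⟨hL1, hL2⟩
    ext p
    constructor
    · intro hp
      obtain ⟨t, ht, t', ht', rfl, hlt⟩ := hL1 p hp
      obtain ⟨t, h1, rfl⟩ := mem_ratCode.1 ht
      obtain ⟨t', h2, rfl⟩ := mem_ratCode.1 ht'
      exact (pair_mem_ltCode h1 h2).2 ((hLT _ _ h1 h2).1 hlt)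
    · intro hp
      obtain ⟨⟨p, h1, h2, h3⟩, rfl⟩ := ZFSet.mem_range.1 hp
      exact hL2 _ (fracCode_mem_ratCode.2 h1) _ (fracCode_mem_ratCode.2 h2) ((hLT _ _ h1 h2).2 h3)

end Arithmetic

/-! ### Continuous functions in elementary submodels -/

section Functions

variable {θ : Cardinal.{u}} {M : setLang.ElementarySubstructure (H θ)}

/-- `t` belongs to the value of the function `f` at `x`. -/
def App (f x t : ZFSet.{u}) : Prop :=
  ∃ p ∈ f, ∃ s ∈ p, ∃ c ∈ s, p = ZFSet.pair x c ∧ t ∈ c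

theorem app_iff {f x t : ZFSet.{u}} : App f x t ↔ ∃ c, ZFSet.pair x c ∈ f ∧ t ∈ c := by
  constructor
  · rintro ⟨p, hp, s, -, c, -, rfl, ht⟩
    exact ⟨c, hp, ht⟩
  · rintro ⟨c, hp, ht⟩
    obtain ⟨s, hs, hc⟩ := mem_pair_right x c
    exact ⟨_, hp, s, hs, c, hc, rfl, ht⟩

theorem app_funCode {K : Type u} (e : K ↪ ZFSet.{u}) {g : K → ℝ} {x : K} {t : ZFSet.{u}} :
    App (funCode e g) (e x) t ↔ t ∈ realCode (g x) := by
  simp [app_iff, pair_mem_funCode]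

theorem Def.app : Def M fun v => App (v 0) (v 1) (v 2) := by
  unfold App
  repeat' first
    | exact Var.proj _ | apply Def.bex | apply Def.and | apply Def.eq_pair | apply Def.mem

/-- `c` is a Dedekind cut in the formal fractions. -/
def IsCut (c : ZFSet.{u}) : Prop :=
  (∀ t ∈ c, t ∈ ratCode) ∧ (∃ t ∈ c, t ∈ ratCode) ∧ (∃ t ∈ ratCode, ¬ t ∈ c) ∧
    (∀ t ∈ c, ∀ t' ∈ ratCode, ZFSet.pair t' t ∈ ltCode → t' ∈ c) ∧
    ∀ t ∈ c, ∃ t' ∈ c, ZFSet.pair t t' ∈ ltCode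

/-- The real number is the supremum of the values of the fractions in `c`; having no largest element
makes the inequality strict. -/
theorem isCut_iff {c : ZFSet.{u}} : IsCut c ↔ ∃ r : ℝ, c = realCode r := by
  constructor
  · rintro ⟨hrat, ⟨t₀, ht₀, -⟩, ⟨t₁, ht₁, ht₁c⟩, hdown, hup⟩
    let S : Set ℝ := {r | ∃ t : ℕ × ℕ × ℕ, 0 < t.2.2 ∧ fracCode t ∈ c ∧ fracVal t = r}
    obtain ⟨t₀, h₀, rfl⟩ := mem_ratCode.1 (hrat _ ht₀)
    obtain ⟨t₁, h₁, rfl⟩ := mem_ratCode.1 ht₁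
    have hne : S.Nonempty := ⟨_, t₀, h₀, ht₀, rfl⟩
    have hbdd : BddAbove S := by
      refine ⟨fracVal t₁, ?_⟩
      rintro _ ⟨t, ht, htc, rfl⟩
      by_contra hlt
      exact ht₁c (hdown _ htc _ ht₁ ((pair_mem_ltCode h₁ ht).2 (not_le.1 hlt)))
    refine ⟨sSup S, ?_⟩
    ext z
    rw [mem_realCode]
    constructor
    · intro hz
      obtain ⟨t, ht, rfl⟩ := mem_ratCode.1 (hrat _ hz)
      obtain ⟨z', hz', hlt⟩ := hup _ hz
      obtain ⟨t', ht', rfl⟩ := mem_ratCode.1 (hrat _ hz')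
      rw [pair_mem_ltCode ht ht'] at hlt
      exact ⟨t, ht, hlt.trans_le (le_csSup hbdd ⟨t', ht', hz', rfl⟩), rfl⟩
    · rintro ⟨t, ht, hlt, rfl⟩
      obtain ⟨_, ⟨t', ht', htc, rfl⟩, hlt'⟩ := exists_lt_of_lt_csSup hne hlt
      exact hdown _ htc _ (fracCode_mem_ratCode.2 ht) ((pair_mem_ltCode ht ht').2 hlt')
  · rintro ⟨r, rfl⟩
    have hrat : ∀ t ∈ realCode.{u} r, t ∈ ratCode := fun t ht => by
      obtain ⟨t, h, -, rfl⟩ := mem_realCode.1 ht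
      exact fracCode_mem_ratCode.2 h
    refine ⟨hrat, ?_, ?_, ?_, ?_⟩
    · obtain ⟨t, ht, -, hlt⟩ := exists_fracVal_between (sub_one_lt r)
      exact ⟨_, (fracCode_mem_realCode ht).2 hlt, fracCode_mem_ratCode.2 ht⟩
    · obtain ⟨t, ht, hlt, -⟩ := exists_fracVal_between (lt_add_one r)
      exact ⟨_, fracCode_mem_ratCode.2 ht, fun h => hlt.not_gt ((fracCode_mem_realCode ht).1 h)⟩
    · intro t ht t' ht' hlt
      obtain ⟨t, h, hr, rfl⟩ := mem_realCode.1 ht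
      obtain ⟨t', h', rfl⟩ := mem_ratCode.1 ht'
      exact (fracCode_mem_realCode h').2 (((pair_mem_ltCode h' h).1 hlt).trans hr)
    · intro t ht
      obtain ⟨t, h, hr, rfl⟩ := mem_realCode.1 ht
      obtain ⟨t', h', hlt, hr'⟩ := exists_fracVal_between hr
      exact ⟨_, (fracCode_mem_realCode h').2 hr', (pair_mem_ltCode h h').2 hlt⟩

theorem Def.isCut (hq : ratCode ∈ elems M) (hlt : ltCode ∈ elems M) :
    Def M fun v => IsCut (v 0) := by
  unfold IsCut
  repeat' first
    | exact Var.proj _ | exact Var.const hq | exact Var.const hlt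
    | apply Def.bex | apply Def.ball | apply Def.and | apply Def.not
    | apply Def.pair_mem | apply Def.mem | apply Def.imp

/-- `f` is a continuous real-valued function on the space with underlying set `k` and base `b`. -/
def IsContCode (k b f : ZFSet.{u}) : Prop :=
  (∀ p ∈ f, ∃ x ∈ k, ∃ s ∈ p, ∃ c ∈ s, p = ZFSet.pair x c ∧ IsCut c) ∧
  (∀ x ∈ k, ∃ p ∈ f, ∃ s ∈ p, ∃ c ∈ s, p = ZFSet.pair x c) ∧
  (∀ x ∈ k, ∀ p ∈ f, ∀ s ∈ p, ∀ c ∈ s, ∀ p' ∈ f, ∀ s' ∈ p', ∀ c' ∈ s',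
    p = ZFSet.pair x c → p' = ZFSet.pair x c' → c = c') ∧
  (∀ x ∈ k, ∀ t ∈ ratCode, App f x t → ∃ U ∈ b, x ∈ U ∧ ∀ y ∈ U, App f y t) ∧
  ∀ x ∈ k, ∀ t ∈ ratCode, ∀ t' ∈ ratCode, ZFSet.pair t t' ∈ ltCode → ¬ App f x t →
    ∃ U ∈ b, x ∈ U ∧ ∀ y ∈ U, ¬ App f y t'

theorem Def.isContCode {k b : ZFSet.{u}} (hk : k ∈ elems M) (hb : b ∈ elems M)
    (hq : ratCode ∈ elems M) (hlt : ltCode ∈ elems M) : Def M fun v => IsContCode k b (v 0) := by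
  unfold IsContCode
  repeat' first
    | exact Var.proj _ | exact Var.const hk | exact Var.const hb
    | exact Var.const hq | exact Var.const hlt
    | apply Def.app.subst₃ | apply (Def.isCut hq hlt).subst₁
    | apply Def.bex | apply Def.ball | apply Def.and | apply Def.not
    | apply Def.eq_pair | apply Def.pair_mem | apply Def.mem | apply Def.imp | apply Def.eq

variable {K : Type u} (e : K ↪ ZFSet.{u})

theorem forall_mem_univCode {P : ZFSet.{u} → Prop} :
    (∀ z ∈ subsetCode e Set.univ, P z) ↔ ∀ x, P (e x) := by
  simp [mem_subsetCode]

theorem exists_mem_univCode {P : ZFSet.{u} → Prop} :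
    (∃ z ∈ subsetCode e Set.univ, P z) ↔ ∃ x, P (e x) := by
  simp [mem_subsetCode]

theorem exists_mem_familyCode {B : Set (Set K)} {P : ZFSet.{u} → Prop} :
    (∃ z ∈ familyCode e B, P z) ↔ ∃ U ∈ B, P (subsetCode e U) := by
  simp [familyCode]

theorem forall_mem_subsetCode {A : Set K} {P : ZFSet.{u} → Prop} :
    (∀ z ∈ subsetCode e A, P z) ↔ ∀ x ∈ A, P (e x) := by
  simp [mem_subsetCode]

theorem forall_mem_ratCode {P : ZFSet.{u} → Prop} :
    (∀ z ∈ ratCode, P z) ↔ ∀ t : ℕ × ℕ × ℕ, 0 < t.2.2 → P (fracCode t) := by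
  simp only [mem_ratCode]
  exact ⟨fun h t ht => h _ ⟨t, ht, rfl⟩, by rintro h _ ⟨t, ht, rfl⟩; exact h t ht⟩

/-- The last two clauses of `IsContCode` are lower and upper semicontinuity. As `App f x t` says `t
< f x`, the upper one starts from `f x ≤ t` and needs the slack `t < t'` to get `f y ≤ t'` nearby.
-/
theorem isContCode_iff [TopologicalSpace K] {B : Set (Set K)}
    (hB : TopologicalSpace.IsTopologicalBasis B) {f : ZFSet.{u}} : IsContCode (subsetCode e Set.univ) (familyCode e B) f ↔
      ∃ g : C(K, ℝ), f = funCode e g := by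
  simp only [IsContCode, forall_mem_univCode, exists_mem_univCode, exists_mem_familyCode,
    apply_mem_subsetCode, forall_mem_subsetCode, forall_mem_ratCode]
  constructor
  · rintro ⟨hcut, htot, hfun, hlow, hupp⟩
    have hex : ∀ x, ∃ r : ℝ, ZFSet.pair (e x) (realCode r) ∈ f := by
      intro x
      obtain ⟨_, hp, s, hs, c, hc, rfl⟩ := htot x
      obtain ⟨x', s', hs', c', hc', heq, hcut'⟩ := hcut _ hp
      obtain ⟨r, rfl⟩ := isCut_iff.1 hcut'
      exact ⟨r, (ZFSet.pair_inj.1 heq).2 ▸ hp⟩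
    choose g hg using hex
    have hf : f = funCode e g := by
      ext p
      rw [mem_funCode]
      constructor
      · intro hp
        obtain ⟨x, s, hs, c, hc, rfl, -⟩ := hcut p hp
        obtain ⟨s', hs', hc'⟩ := mem_pair_right (e x) (realCode (g x))
        exact ⟨x, by rw [hfun x _ hp s hs c hc _ (hg x) s' hs' _ hc' rfl rfl]⟩
      · rintro ⟨x, rfl⟩
        exact hg x
    subst hf
    simp only [app_funCode] at hlow hupp
    refine ⟨⟨g, continuous_iff_continuousAt.2 fun x => tendsto_order.2 ⟨fun a ha => ?_,
      fun a ha => ?_⟩⟩, rfl⟩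
    · obtain ⟨t, ht, hat, htg⟩ := exists_fracVal_between ha
      obtain ⟨U, hUB, hxU, hU⟩ := hlow x t ht ((fracCode_mem_realCode ht).2 htg)
      filter_upwards [(hB.isOpen hUB).mem_nhds hxU] with y hy
      exact hat.trans ((fracCode_mem_realCode ht).1 (hU y hy))
    · obtain ⟨t', ht', hat', htg'⟩ := exists_fracVal_between ha
      obtain ⟨t, ht, hat, htg⟩ := exists_fracVal_between hat'
      obtain ⟨U, hUB, hxU, hU⟩ := hupp x t ht t' ht' ((pair_mem_ltCode ht ht').2 htg)
        fun h => hat.not_gt ((fracCode_mem_realCode ht).1 h)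
      filter_upwards [(hB.isOpen hUB).mem_nhds hxU] with y hy
      exact lt_of_le_of_lt
        (not_lt.1 fun h => hU y hy ((fracCode_mem_realCode ht').2 h)) htg'
  · rintro ⟨g, rfl⟩
    simp only [app_funCode]
    refine ⟨?_, ?_, ?_, ?_, ?_⟩
    · intro p hp
      obtain ⟨x, rfl⟩ := (mem_funCode e).1 hp
      obtain ⟨s, hs, hc⟩ := mem_pair_right (e x) (realCode (g x))
      exact ⟨x, s, hs, _, hc, rfl, isCut_iff.2 ⟨_, rfl⟩⟩
    · intro x
      obtain ⟨s, hs, hc⟩ := mem_pair_right (e x) (realCode (g x))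
      exact ⟨_, (pair_mem_funCode e).2 rfl, s, hs, _, hc, rfl⟩
    · rintro x p hp s - c - p' hp' s' - c' - rfl rfl
      rw [pair_mem_funCode] at hp hp'
      rw [hp, hp']
    · intro x t ht hx
      rw [fracCode_mem_realCode ht] at hx
      obtain ⟨U, hUB, hxU, hU⟩ := hB.exists_subset_of_mem_open (u := {y | fracVal t < g y}) hx
        (isOpen_lt continuous_const g.continuous)
      exact ⟨U, hUB, hxU, fun y hy => (fracCode_mem_realCode ht).2 (hU hy)⟩
    · intro x t ht t' ht' hlt hx
      rw [fracCode_mem_realCode ht, not_lt] at hx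
      rw [pair_mem_ltCode ht ht'] at hlt
      obtain ⟨U, hUB, hxU, hU⟩ := hB.exists_subset_of_mem_open (u := {y | g y < fracVal t'})
        (hx.trans_lt hlt) (isOpen_lt g.continuous continuous_const)
      refine ⟨U, hUB, hxU, fun y hy h => ?_⟩
      exact lt_asymm (hU hy) ((fracCode_mem_realCode ht').1 h)

end Functions

/-! ### `κ`-Corson compacta have Property `B(κ)` -/

section CorsonToB

/-- The formal fraction `0 / 1`. -/
noncomputable def zeroFrac : ZFSet.{u} :=
  fracCode (0, 0, 1)

theorem zeroFrac_mem_realCode {r : ℝ} : zeroFrac.{u} ∈ realCode r ↔ 0 < r := by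
  rw [zeroFrac, fracCode_mem_realCode (by norm_num)]
  simp [fracVal]

theorem zeroFrac_mem_elems {θ : Cardinal.{u}} {M : setLang.ElementarySubstructure (H θ)}
    (h0 : ∅ ∈ elems M) (hω : omegaCode ∈ elems M) (h : zeroFrac ∈ H θ) :
    zeroFrac ∈ elems M := by
  have h1 : zeroFrac.{u} = ZFSet.pair (ZFSet.pair ∅ ∅) (insert ∅ ∅) := by
    rw [zeroFrac, fracCode, ← natCode_zero, ← natCode_succ]
  refine mem_elems_of_unique (R := fun t => ∃ i ∈ omegaCode, i = insert ∅ ∅ ∧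
    t = ZFSet.pair (ZFSet.pair ∅ ∅) i) ?_ h ?_ ?_
  · repeat' first
      | exact Var.proj _ | exact Var.const h0 | exact Var.const hω
      | apply Def.bex | apply Def.and | apply Def.eq_succ | apply Def.eq_triple
  · refine ⟨_, natCode_mem_omegaCode 1, ?_, ?_⟩
    · rw [natCode_succ, natCode_zero]
    · rw [h1, natCode_succ, natCode_zero]
  · rintro _ ⟨_, -, rfl, rfl⟩
    exact h1.symm

/-- `g` maps a subset of `α` onto a set that includes all `f ∈ F` with positive value at `x`. -/
def Enumerates (F x α g : ZFSet.{u}) : Prop :=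
  (∀ f ∈ F, App f x zeroFrac → ∃ β ∈ α, ZFSet.pair β f ∈ g) ∧
    ∀ β ∈ α, ∀ f ∈ F, ∀ f' ∈ F, ZFSet.pair β f ∈ g → ZFSet.pair β f' ∈ g → f = f'

/-- `F` is a family of continuous functions such that any two points are separated by a member
of `F` that is positive at one of them, and fewer than `κ` members are positive at each point. -/
def IsSeparatingFamily (θ : Cardinal.{u}) (k b κ F : ZFSet.{u}) : Prop :=
  (∀ f ∈ F, IsContCode k b f) ∧
  (∀ x ∈ k, ∀ y ∈ k, ¬ x = y → ∃ f ∈ F, ∃ t ∈ ratCode,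
    (App f x t ∧ ¬ App f y t ∨ App f y t ∧ ¬ App f x t) ∧
      (App f x zeroFrac ∨ App f y zeroFrac)) ∧
  ∀ x ∈ k, ∃ α ∈ κ, ∃ g ∈ H θ, Enumerates F x α g

theorem exists_enumerates {K : Type u} (e : K ↪ ZFSet.{u}) {S : Type u} (g : S → K → ℝ)
    {κ : Cardinal.{u}} {x : K} (hκ : #{s // g s x ≠ 0} < κ) :
    ∃ α ∈ κ.ord.toZFSet, ∃ h,
      Enumerates (ZFSet.range fun s => funCode e (g s)) (e x) α h := by
  -- Well-ordering the support in the order type of its cardinality gives an index ordinal below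
  -- `κ`.
  obtain ⟨r, _, hr⟩ := exists_ord_eq {s // g s x ≠ 0}
  refine ⟨(Ordinal.type r).toZFSet, ?_, ZFSet.range fun s : {s // g s x ≠ 0} =>
    ZFSet.pair (Ordinal.typein r s).toZFSet (funCode e (g s)), ?_, ?_⟩
  · rw [Ordinal.toZFSet_mem_toZFSet_iff, ← hr]
    exact ord_lt_ord.2 hκ
  · intro f hf hpos
    obtain ⟨s, rfl⟩ := ZFSet.mem_range.1 hf
    rw [app_funCode, zeroFrac_mem_realCode] at hpos
    exact ⟨_, Ordinal.toZFSet_mem_toZFSet_iff.2 (Ordinal.typein_lt_type r ⟨s, hpos.ne'⟩),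
      ZFSet.mem_range.2 ⟨⟨s, hpos.ne'⟩, rfl⟩⟩
  · intro β _ f _ f' _ h h'
    obtain ⟨s, hs⟩ := ZFSet.mem_range.1 h
    obtain ⟨s', hs'⟩ := ZFSet.mem_range.1 h'
    rw [ZFSet.pair_inj] at hs hs'
    have : s = s' := Ordinal.typein_injective r (Ordinal.toZFSet_injective (hs.1.trans hs'.1.symm))
    rw [← hs.2, ← hs'.2, this]

/-- A member of a separating family in `M` that is positive at a point of `K ∩ M` belongs
to `M`. -/
theorem mem_elems_of_app {κ θ : Cardinal.{u}} {M : setLang.ElementarySubstructure (H θ)}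
    (hM : IsStable κ M) (hz : zeroFrac ∈ elems M) {k b F : ZFSet.{u}} (hF : F ∈ elems M)
    (hsep : IsSeparatingFamily θ k b κ.ord.toZFSet F) {x : ZFSet.{u}} (hx : x ∈ elems M)
    (hxk : x ∈ k) {f : ZFSet.{u}} (hf : f ∈ F) (hpos : App f x zeroFrac) : f ∈ elems M := by
  have hκ := hM.1
  obtain ⟨α, hα, hακ, hex⟩ := exists_mem_elems (M := M)
    (R := fun α => α ∈ κ.ord.toZFSet ∧ ∃ g ∈ H θ, Enumerates F x α g) (by
      unfold Enumerates
      repeat' first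
        | exact Var.proj _ | exact Var.const hκ | exact Var.const hF | exact Var.const hx
        | exact Var.const hz | apply Def.app.subst₃
        | apply Def.ex | apply Def.bex | apply Def.ball | apply Def.and
        | apply Def.pair_mem | apply Def.mem | apply Def.imp | apply Def.eq) (by
      obtain ⟨α, hα, h⟩ := hsep.2.2 x hxk
      exact ⟨α, H_transitive (mem_H_of_mem_elems hκ) hα, hα, h⟩)
  obtain ⟨g, hg, hen⟩ := exists_mem_elems (M := M) (R := fun g => Enumerates F x α g) (by
      unfold Enumerates
      repeat' first
        | exact Var.proj _ | exact Var.const hα | exact Var.const hF | exact Var.const hx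
        | exact Var.const hz | apply Def.app.subst₃
        | apply Def.bex | apply Def.ball | apply Def.and
        | apply Def.pair_mem | apply Def.mem | apply Def.imp | apply Def.eq) hex
  obtain ⟨β, hβ, hβf⟩ := hen.1 f hf hpos
  -- Stability enters here: `α ∈ κ ∩ M` gives `β ∈ M`, and `f` is definable from `β`, `g` and `F`.
  have hβM : β ∈ elems M := hM.2 α hακ hα β hβ
  refine mem_elems_of_unique (R := fun f => f ∈ F ∧ ZFSet.pair β f ∈ g) ?_
    (H_transitive (mem_H_of_mem_elems hF) hf) ⟨hf, hβf⟩
    fun f' hf' => hen.2 β hβ f' hf'.1 f hf hf'.2 hβf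
  repeat' first
    | exact Var.proj _ | exact Var.const hβM | exact Var.const hF | exact Var.const hg
    | apply Def.and | apply Def.pair_mem | apply Def.mem

theorem isSeparatingFamily_range {K : Type u} [TopologicalSpace K] (e : K ↪ ZFSet.{u})
    {B : Set (Set K)} (hB : TopologicalSpace.IsTopologicalBasis B) {κ θ : Cardinal.{u}}
    {S : Type u} (g : S → C(K, ℝ)) (hnonneg : ∀ s x, 0 ≤ g s x)
    (hinj : ∀ x y, (∀ s, g s x = g s y) → x = y)
    (hen : ∀ x, ∃ α ∈ κ.ord.toZFSet, ∃ h ∈ H θ,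
      Enumerates (ZFSet.range fun s => funCode e (g s)) (e x) α h) :
    IsSeparatingFamily θ (subsetCode e Set.univ) (familyCode e B) κ.ord.toZFSet
      (ZFSet.range fun s => funCode e (g s)) := by
  refine ⟨?_, ?_, ?_⟩
  · intro f hf
    obtain ⟨s, rfl⟩ := ZFSet.mem_range.1 hf
    exact (isContCode_iff e hB).2 ⟨g s, rfl⟩
  · simp only [forall_mem_univCode]
    intro x y hxy
    have hne : ∃ s, g s x ≠ g s y := by
      by_contra! hall
      exact hxy (congrArg e (hinj x y hall))
    obtain ⟨s, hs⟩ := hne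
    refine ⟨_, ZFSet.mem_range_self s, ?_⟩
    simp only [app_funCode, zeroFrac_mem_realCode]
    rcases lt_or_gt_of_ne hs with hlt | hlt
    · obtain ⟨t, ht, h1, h2⟩ := exists_fracVal_between hlt
      refine ⟨fracCode t, fracCode_mem_ratCode.2 ht, Or.inr ?_, Or.inr ((hnonneg s x).trans_lt hlt)⟩
      rw [fracCode_mem_realCode ht, fracCode_mem_realCode ht]
      exact ⟨h2, h1.not_gt⟩
    · obtain ⟨t, ht, h1, h2⟩ := exists_fracVal_between hlt
      refine ⟨fracCode t, fracCode_mem_ratCode.2 ht, Or.inl ?_, Or.inl ((hnonneg s y).trans_lt hlt)⟩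
      rw [fracCode_mem_realCode ht, fracCode_mem_realCode ht]
      exact ⟨h2, h1.not_gt⟩
  · simpa only [forall_mem_univCode] using hen

theorem propertyB_of_isKappaCorson {κ : Cardinal.{u}} {K : Type u} [TopologicalSpace K]
    (e : K ↪ ZFSet.{u}) (hK : IsKappaCorson κ K) : PropertyB κ e := by
  obtain ⟨S, φ, hφ⟩ := hK
  let g : S → C(K, ℝ) := fun s => ⟨fun x => ((φ x).1 s : ℝ),
    continuous_subtype_val.comp ((continuous_apply s).comp
      (continuous_subtype_val.comp hφ.continuous))⟩
  have hsupp : ∀ x, #{s // g s x ≠ 0} < κ := fun x => by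
    refine lt_of_le_of_lt (le_of_eq ?_) (φ x).2
    refine mk_congr (Equiv.subtypeEquivRight fun s => not_congr ?_)
    exact ⟨fun h => Subtype.ext h, fun h => congrArg Subtype.val h⟩
  choose α hα h hen using fun x => exists_enumerates e (fun s => g s) (hsupp x)
  let F : ZFSet.{u} := ZFSet.range fun s => funCode e (g s)
  let par : Fin 8 → ZFSet.{u} := ![∅, omegaCode, opCode (· + ·), opCode (· * ·), ratCode, ltCode,
    zeroFrac, F]
  -- `H θ` must also contain the enumerations `h x`, because `IsSeparatingFamily` looks for them
  -- inside `H θ`.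
  obtain ⟨θ₀, hθ₀⟩ := exists_forall_mem_H (Sum.elim h fun i : ULift.{u} (Fin 8) => par i.down)
  refine ⟨θ₀, fun θ hθ M hM hKM _ x hx y hy hxy => ?_⟩
  have hpar : ∀ i, par i ∈ H θ := fun i => hθ₀ θ hθ (Sum.inr ⟨i⟩)
  obtain ⟨hk, B, hB, hb⟩ := hKM
  have hκ := hM.1
  have h0 : ∅ ∈ elems M := empty_mem_elems (hpar 0)
  have hω : omegaCode ∈ elems M := omegaCode_mem_elems (hpar 1)
  have hadd : opCode (· + ·) ∈ elems M := addCode_mem_elems h0 hω (hpar 2)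
  have hmul : opCode (· * ·) ∈ elems M := mulCode_mem_elems h0 hω hadd (hpar 3)
  have hq : ratCode ∈ elems M := ratCode_mem_elems h0 hω (hpar 4)
  have hlt : ltCode ∈ elems M := ltCode_mem_elems hω hadd hmul hq (hpar 5)
  have hz : zeroFrac ∈ elems M := zeroFrac_mem_elems h0 hω (hpar 6)
  have hFsep : IsSeparatingFamily θ (subsetCode e Set.univ) (familyCode e B) κ.ord.toZFSet F :=
    isSeparatingFamily_range e hB g (fun s x => ((φ x).1 s).2.1)
      (fun x y hall => hφ.injective (Subtype.ext (funext fun s => Subtype.ext (hall s))))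
      fun x => ⟨α x, hα x, h x, hθ₀ θ hθ (Sum.inl x), hen x⟩
  -- The coordinate family `F` need not belong to `M`; it only witnesses that a separating family
  -- exists, and `M` supplies its own.
  obtain ⟨F', hF', hsep⟩ := exists_mem_elems (M := M)
    (R := fun F => IsSeparatingFamily θ (subsetCode e Set.univ) (familyCode e B) κ.ord.toZFSet F)
    (by
      unfold IsSeparatingFamily Enumerates
      repeat' first
        | exact Var.proj _ | exact Var.const hκ | exact Var.const hk | exact Var.const hq
        | exact Var.const hz | apply Def.app.subst₃ | apply (Def.isContCode hk hb hq hlt).subst₁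
        | apply Def.ex | apply Def.bex | apply Def.ball | apply Def.and | apply Def.or
        | apply Def.not | apply Def.pair_mem | apply Def.mem | apply Def.imp | apply Def.eq)
    ⟨F, hpar 7, hFsep⟩
  by_contra hne
  have hxk : ∀ z, e z ∈ subsetCode e Set.univ := fun z => (apply_mem_subsetCode e).2 trivial
  obtain ⟨f, hf, t, ht, hdiff, hpos⟩ := hsep.2.1 _ (hxk x) _ (hxk y) fun h => hne (e.injective h)
  obtain ⟨w, rfl⟩ := (isContCode_iff e hB).1 (hsep.1 f hf)
  simp only [app_funCode] at hdiff hpos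
  have hmem : ∀ z ∈ closure (pointsIn e M), zeroFrac ∈ realCode (w z) →
      funCode e w ∈ elems M := by
    intro z hz' hwz
    -- The set where `w` is positive is open, so it meets `K ∩ M`.
    obtain ⟨d, hd, hdM⟩ := mem_closure_iff.1 hz' _ (isOpen_lt continuous_const w.continuous)
      (zeroFrac_mem_realCode.1 hwz)
    exact mem_elems_of_app hM hz hF' hsep hdM (hxk d) hf
      ((app_funCode e).2 (zeroFrac_mem_realCode.2 hd))
  have heq : w x = w y := hxy w (hpos.elim (hmem x hx) (hmem y hy))
  rw [heq] at hdiff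
  tauto

end CorsonToB

end KappaCorson

theorem mainTheorem1 (κ : Cardinal.{u}) (hreg : κ.IsRegular) (hunc : Cardinal.aleph0 < κ)
    (K : Type u) [TopologicalSpace K] [CompactSpace K] [T2Space K] (e : K ↪ ZFSet.{u}) :
    KappaCorson.IsKappaCorson κ K ↔ KappaCorson.PropertyB κ e :=
  ⟨KappaCorson.propertyB_of_isKappaCorson e, KappaCorson.isKappaCorson_of_propertyB hreg hunc⟩
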